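/- \textbf{Setting.} Let $\ell\ge 3$. An $\ell$-hypergraph is a structure with one $\ell$-ary relation that contains only injective tuples and is invariant under permuting the entries of tuples. Let $\mathcal K$ be a finitely bounded class of finite $\ell$-hypergraphs: $\mathcal K$ consists of all finite $\ell$-hypergraphs into which no member of some finite set $\mathcal F$ of finite $\ell$-hypergraphs embeds; let $b_{\mathbb H}$ be an integer such that all members of $\mathcal F$ have at most $b_{\mathbb H}$ elements. Let $\vec{\mathcal K}$ be the class of all expansions of members of $\mathcal K$ by a linear order, and assume that $\vec{\mathcal K}$ is an amalgamation (Fra\"iss\'e) class. Let $(\mathbb H,<)$ be its Fra\"iss\'e limit, where $\mathbb H$ is the hypergraph reduct, with domain $H$. Let $I_n\subseteq H^n$ be the set of injective $n$-tuples. Let $E$ be the set of tuples in the hyperedge relation of $\mathbb H$ and $N=I_\ell\setminus E$; when non-empty, these are the injective orbits of $\ell$-tuples under $\operatorname{Aut}(\mathbb H)$. Write $O(a)$ and $O_<(a)$ for the orbits of a tuple $a$ under $\operatorname{Aut}(\mathbb H)$ and $\operatorname{Aut}(\mathbb H,<)$. An operation on $H$ is canonical with respect to $(\mathbb H,<)$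 if, applied componentwise to $k$-tuples, it maps arguments that come from the same orbits under $\operatorname{Aut}(\mathbb H,<)$ to results in the same orbit, for every $k$. Let $\mathbb A$ be a first-order reduct of $\mathbb H$, i.e. a relational structure on $H$ all of whose relations are first-order definable in $\mathbb H$ without parameters. It \emph{admits (injective) linear symmetries} if it has a ternary injective polymorphism $m$, canonical with respect to $(\mathbb H,<)$, such that $O(m(a,a,b))=O(m(a,b,a))=O(m(b,a,a))=O(b)$ for all $a,b\in I_\ell$. In this case, fix a binary injective polymorphism $p_1$ of $\mathbb A$ that is canonical with respect to $(\mathbb H,<)$, satisfies $O(p_1(a,b))=O(a)$ for all $a,b\in I_\ell$, and satisfies $p_1(x,y)<p_1(x',y')$ whenever $y<y'$, or $y=y'$ and $x<x'$. A non-injective orbit $O$ of $\ell$-tuples under $\operatorname{Aut}(\mathbb H)$ is \emph{deterministic} if for every $a\in O$ there is $\alpha\in\operatorname{Aut}(\mathbb H)$ such that $O_<(p_1(\alpha a,e))=O_<(p_1(\alpha a,n))$ for all strictly increasing $e\in E$ and $n\in N$; otherwise it is \emph{non-deterministic}. \textbf{Instances.} A CSP instance $\mathcal I=(\mathcal V,\mathcal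 C)$ over a set $B$ has a set $\mathcal V$ of variables (here finite and linearly ordered, for $B=H$) and constraints $C\subseteq B^U$ with scopes $U\subseteq\mathcal V$; a solution is a map $f:\mathcal V\to B$ with $f|_U\in C$ for every constraint $C$ with scope $U$. It is an instance of $\operatorname{CSP}(\mathbb A)$ if each constraint is given by a relation of $\mathbb A$ under an enumeration of its scope. It is non-trivial if no constraint is empty. It is $(m,n)$-minimal if every set of at most $n$ variables is contained in the scope of a constraint, and any two constraints have the same projection to each tuple of at most $m$ variables lying in both scopes; this projection is then written $\operatorname{proj}_{v}(\mathcal I)$. It is $m$-minimal if it is $(m,m)$-minimal. For variables $v,w$ and values $a,b$, one \emph{step} leads from $(v,a)$ to $(w,b)$ if some constraint has $v,w$ in its scope and contains a map with $v\mapsto a$, $w\mapsto b$. The linkedness congruence on the projection to $v$ \emph{links} $a$ and $b$ if finitely many (at least one) steps lead from $(v,a)$ to $(v,b)$. The \emph{finitisation} $\mathcal I_{\mathrm{fin}}$ of an instance $\mathcal I$ over $H$ has as variables the set $[\mathcal V]^\ell$ of increasing injective $\ell$-tuples of variables, as domain the set of orbits of $\ell$-tuples under $\operatorname{Aut}(\mathbb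 H)$, and for each constraint $C\subseteq H^U$ the constraint of all maps $g$ on $[U]^\ell$ for which there is $f\in C$ with $f(t)\in g(t)$ for all $t\in[U]^\ell$. The injectivisation $\mathcal J^{(\mathrm{inj})}$ of an instance $\mathcal J$ over the set of orbits is obtained by removing from its constraints all maps taking a value outside $\{E,N\}$. A non-trivial $\ell$-minimal instance $\mathcal I$ is \emph{inj-irreducible} if for every $S\subseteq[\mathcal V]^\ell$, with $\mathcal J$ the restriction of $\mathcal I_{\mathrm{fin}}$ to $S$, one of the following holds: (i) $\mathcal J^{(\mathrm{inj})}$ has a solution; (ii) for some $v\in S$, $\operatorname{proj}_v(\mathcal J)$ contains both $E$ and $N$, and they are not linked; (iii) for some $v\in S$, the linkedness congruence on $\operatorname{proj}_v(\mathcal J)$ links an injective orbit to a non-deterministic orbit. \textbf{Theorem.} Suppose that $\mathbb A$ admits linear symmetries, and let $p_1$ be as above. Let $\mathcal I$ be a $(2\ell,\max(3\ell,b_{\mathbb H}))$-minimal, inj-irreducible instance of $\operatorname{CSP}(\mathbb A)$ with variable set $\mathcal V$ such that $\operatorname{proj}_{(u,v)}(\mathcal I)\cap I_2\neq\emptyset$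 for all distinct $u,v\in\mathcal V$. Then $\mathcal I$ has an injective solution. -/

import Mathlib

universe u v w x

namespace HypergraphCSP

open FirstOrder FirstOrder.Language CategoryTheory

/-! ### Hypergraphs, their ordered expansions, and finite boundedness -/

/-- The relation symbols of the language of `ℓ`-hypergraphs: one symbol, of arity `ℓ`. -/
inductive EdgeSymbol (ℓ : ℕ) : ℕ → Type
  | edge : EdgeSymbol ℓ ℓ

/-- The relational language of `ℓ`-hypergraphs. -/
def hyperLang (ℓ : ℕ) : FirstOrder.Language.{0, 0} where
  Functions := fun _ => Empty
  Relations := EdgeSymbol ℓ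

instance (ℓ : ℕ) : (hyperLang ℓ).IsRelational := fun _ => inferInstanceAs (IsEmpty Empty)

/-- The tuple `a` is a hyperedge of the structure `M`. -/
def IsEdge {ℓ : ℕ} {M : Type*} [(hyperLang ℓ).Structure M] (a : Fin ℓ → M) : Prop :=
  Structure.RelMap (L := hyperLang ℓ) (EdgeSymbol.edge : EdgeSymbol ℓ ℓ) a

/-- `M` is an `ℓ`-hypergraph: all tuples in its relation are injective, and the relation is
invariant under permutations of the entries of its tuples. -/
def IsHypergraph (ℓ : ℕ) (M : Type*) [(hyperLang ℓ).Structure M] : Prop :=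
  (∀ a : Fin ℓ → M, IsEdge a → Function.Injective a) ∧
    ∀ (a : Fin ℓ → M) (σ : Equiv.Perm (Fin ℓ)), IsEdge a → IsEdge (a ∘ σ)

/-- `K` is the class of all finite `ℓ`-hypergraphs into which no member of some finite set of
finite `ℓ`-hypergraphs with at most `b` elements embeds.  So `K` is finitely bounded, and `b` is an
integer witnessing it. -/
def IsFinitelyBoundedBy {ℓ : ℕ} (K : Set (Bundled.{u} (hyperLang ℓ).Structure)) (b : ℕ) : Prop :=
  ∃ F : Set (Bundled.{u} (hyperLang ℓ).Structure),
    F.Finite ∧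
    (∀ N ∈ F, IsHypergraph ℓ N ∧ Finite N ∧ Nat.card N ≤ b) ∧
    ∀ M : Bundled.{u} (hyperLang ℓ).Structure,
      M ∈ K ↔ IsHypergraph ℓ M ∧ Finite M ∧ ∀ N ∈ F, IsEmpty (N ↪[hyperLang ℓ] M)

/-- The language of ordered `ℓ`-hypergraphs. -/
abbrev orderedLang (ℓ : ℕ) : FirstOrder.Language.{0, 0} := (hyperLang ℓ).sum Language.order

/-- The expansion `(M, <)` of a structure `M` by a linear order. -/
@[reducible] def orderedStructure {ℓ : ℕ} {M : Type*} (h : (hyperLang ℓ).Structure M)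
    (lo : LinearOrder M) : (orderedLang ℓ).Structure M :=
  letI := h
  letI := lo
  letI : Language.order.Structure M := orderStructure M
  Language.sumStructure (hyperLang ℓ) Language.order M

/-- The class of all expansions of members of `K` by a linear order. -/
def orderedClass {ℓ : ℕ} (K : Set (Bundled.{u} (hyperLang ℓ).Structure)) :
    Set (Bundled.{u} (orderedLang ℓ).Structure) :=
  {M | ∃ (h : (hyperLang ℓ).Structure M) (lo : LinearOrder M),
    (⟨M, h⟩ : Bundled.{u} (hyperLang ℓ).Structure) ∈ K ∧ M.str = orderedStructure h lo}

/-- `(H, <)` is the Fraïssé limit of the class of linearly ordered members of `K`. -/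
def IsOrderedFraisseLimit {ℓ : ℕ} (K : Set (Bundled.{u} (hyperLang ℓ).Structure)) (H : Type u)
    [h : (hyperLang ℓ).Structure H] [lo : LinearOrder H] [Countable H] : Prop :=
  letI : (orderedLang ℓ).Structure H := orderedStructure h lo
  IsFraisseLimit (orderedClass K) H

/-! ### Orbits -/

section Orbits

variable (ℓ : ℕ) {H : Type u} [(hyperLang ℓ).Structure H]

/-- The tuples `a` and `b` are in the same orbit under the automorphism group of the hypergraph. -/
def SameOrbit {k : ℕ} (a b : Fin k → H) : Prop :=
  ∃ α : H ≃[hyperLang ℓ] H, ∀ i, α (a i) = b i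

/-- The tuples `a` and `b` are in the same orbit under the automorphism group of the ordered
hypergraph. -/
def SameOrderedOrbit [LinearOrder H] {k : ℕ} (a b : Fin k → H) : Prop :=
  ∃ α : H ≃[hyperLang ℓ] H, StrictMono α ∧ ∀ i, α (a i) = b i

variable (H) in
/-- The orbit equivalence relation on `ℓ`-tuples. -/
def orbitSetoid : Setoid (Fin ℓ → H) where
  r := SameOrbit ℓ
  iseqv :=
    { refl := fun _ => ⟨Language.Equiv.refl _ _, fun _ => rfl⟩
      symm := by
        rintro a b ⟨α, h⟩
        exact ⟨α.symm, fun i => by rw [← h i, Language.Equiv.symm_apply_apply]⟩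
      trans := by
        rintro a b c ⟨α, h⟩ ⟨β, h'⟩
        exact ⟨β.comp α, fun i => by rw [Language.Equiv.comp_apply, h, h']⟩ }

variable (H) in
/-- The set of orbits of `ℓ`-tuples under the automorphism group of the hypergraph. -/
def Orbit : Type u := Quotient (orbitSetoid ℓ H)

variable {ℓ}

/-- The orbit of an `ℓ`-tuple. -/
def orbitOf (a : Fin ℓ → H) : Orbit ℓ H := Quotient.mk (orbitSetoid ℓ H) a

/-- `O` is the orbit `E` of the tuples in the hyperedge relation. -/
def IsE (O : Orbit ℓ H) : Prop :=
  ∃ a : Fin ℓ → H, orbitOf a = O ∧ Function.Injective a ∧ IsEdge a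

/-- `O` is the orbit `N` of the injective tuples that are not in the hyperedge relation. -/
def IsN (O : Orbit ℓ H) : Prop :=
  ∃ a : Fin ℓ → H, orbitOf a = O ∧ Function.Injective a ∧ ¬ IsEdge a

/-- `O` is an injective orbit, i.e. one of `E` and `N`. -/
def IsInjOrbit (O : Orbit ℓ H) : Prop := IsE O ∨ IsN O

end Orbits

/-! ### Polymorphisms and canonical functions -/

section Functions

/-- The function `f` preserves all relations of the structure `A` on `H`. -/
def IsPolymorphism (LA : FirstOrder.Language.{v, w}) {H : Type u} [LA.Structure H] {n : ℕ}
    (f : (Fin n → H) → H) : Prop :=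
  ∀ (k : ℕ) (R : LA.Relations k) (t : Fin n → Fin k → H),
    (∀ i, Structure.RelMap R (t i)) → Structure.RelMap R (fun j => f (fun i => t i j))

/-- The relational structure `A` (in the language `LA`) on `H` is a first-order reduct of the
hypergraph on `H`: all its relations are first-order definable there without parameters. -/
def IsFirstOrderReduct (ℓ : ℕ) (LA : FirstOrder.Language.{v, w}) (H : Type u) [(hyperLang ℓ).Structure H]
    [LA.Structure H] : Prop :=
  ∀ (k : ℕ) (R : LA.Relations k),
    (∅ : Set H).Definable (hyperLang ℓ) {a : Fin k → H | Structure.RelMap R a}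

variable (ℓ : ℕ) {H : Type u} [(hyperLang ℓ).Structure H] [LinearOrder H]

/-- `f` is canonical with respect to the ordered hypergraph on `H`: it maps tuples from the same
orbits under the automorphism group of `(H, <)` to tuples from the same orbit. -/
def IsCanonical {n : ℕ} (f : (Fin n → H) → H) : Prop :=
  ∀ (k : ℕ) (s t : Fin n → Fin k → H), (∀ i, SameOrderedOrbit ℓ (s i) (t i)) →
    SameOrderedOrbit ℓ (fun j => f (fun i => s i j)) (fun j => f (fun i => t i j))

variable (LA : FirstOrder.Language.{v, w}) [LA.Structure H]

/-- `m` is an injective linear symmetry of `A`: a ternary injective polymorphism which is canonical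
with respect to `(H, <)` and acts as a minority on the orbits of injective `ℓ`-tuples. -/
def IsInjectiveLinearSymmetry (m : (Fin 3 → H) → H) : Prop :=
  Function.Injective m ∧ IsPolymorphism LA m ∧ IsCanonical ℓ m ∧
    ∀ a b : Fin ℓ → H, Function.Injective a → Function.Injective b →
      SameOrbit ℓ (fun i => m ![a i, a i, b i]) b ∧
      SameOrbit ℓ (fun i => m ![a i, b i, a i]) b ∧
      SameOrbit ℓ (fun i => m ![b i, a i, a i]) b

variable (H) in
/-- The structure `A` on `H` admits an injective linear symmetry. -/
def AdmitsLinearSymmetries : Prop :=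
  ∃ m : (Fin 3 → H) → H, IsInjectiveLinearSymmetry ℓ LA m

/-- The standing properties of the binary operation `p₁`: it is an injective polymorphism of `A`,
canonical with respect to `(H, <)`, acts as the first projection on `{E, N}`, and is
lexicographic on the order, with the second argument the more significant one. -/
def IsLexFirstProjection (p₁ : (Fin 2 → H) → H) : Prop :=
  Function.Injective p₁ ∧ IsPolymorphism LA p₁ ∧ IsCanonical ℓ p₁ ∧
    (∀ a b : Fin ℓ → H, Function.Injective a → Function.Injective b →
      SameOrbit ℓ (fun i => p₁ ![a i, b i]) a) ∧
    ∀ x y x' y' : H, y < y' ∨ (y = y' ∧ x < x') → p₁ ![x, y] < p₁ ![x', y']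

variable {ℓ}

/-- The non-injective orbit `O` is deterministic (with respect to `p₁`). -/
def IsDeterministic (p₁ : (Fin 2 → H) → H) (O : Orbit ℓ H) : Prop :=
  ¬ IsInjOrbit O ∧
    ∀ a : Fin ℓ → H, orbitOf a = O → ∃ α : H ≃[hyperLang ℓ] H,
      ∀ e n : Fin ℓ → H, StrictMono e → IsEdge e → StrictMono n → ¬ IsEdge n →
        SameOrderedOrbit ℓ (fun i => p₁ ![α (a i), e i]) (fun i => p₁ ![α (a i), n i])

/-- The non-injective orbit `O` is non-deterministic (with respect to `p₁`). -/
def IsNonDeterministic (p₁ : (Fin 2 → H) → H) (O : Orbit ℓ H) : Prop :=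
  ¬ IsInjOrbit O ∧ ¬ IsDeterministic p₁ O

end Functions

/-! ### CSP instances -/

/-- A constraint over the set `B`, on variables from `V`: a set of maps from its scope to `B`. -/
structure Constraint (V : Type v) (B : Type u) where
  /-- The scope of the constraint. -/
  scope : Set V
  /-- The maps from the scope that the constraint allows. -/
  maps : Set (scope → B)

/-- A CSP instance with variable set `V` over the set `B`, given by its set of constraints. -/
structure Instance (V : Type v) (B : Type u) where
  /-- The constraints of the instance. -/
  constraints : Set (Constraint V B)

namespace Instance

variable {V : Type v} {B : Type u}

/-- The map `f` is a solution of the instance. -/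
def IsSolution (I : Instance V B) (f : V → B) : Prop :=
  ∀ C ∈ I.constraints, (fun y : C.scope => f y) ∈ C.maps

/-- No constraint of the instance is empty. -/
def IsNontrivial (I : Instance V B) : Prop :=
  ∀ C ∈ I.constraints, C.maps.Nonempty

/-- The instance is an instance of the CSP of the structure `A` on `B`: every constraint consists of
the maps that satisfy some relation of `A` under some enumeration of the scope. -/
def IsInstanceOf (I : Instance V B) (LA : FirstOrder.Language.{w, x}) [LA.Structure B] : Prop :=
  ∀ C ∈ I.constraints, ∃ (k : ℕ) (R : LA.Relations k) (s : Fin k → C.scope),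
    Function.Surjective s ∧ C.maps = {f | Structure.RelMap R (f ∘ s)}

end Instance

/-- The projection of the constraint `C` to the tuple `t` of variables from its scope. -/
def Constraint.proj {V : Type v} {B : Type u} (C : Constraint V B) {k : ℕ} (t : Fin k → C.scope) :
    Set (Fin k → B) :=
  {a | ∃ f ∈ C.maps, f ∘ t = a}

namespace Instance

variable {V : Type v} {B : Type u}

/-- `(m, n)`-minimality: every set of at most `n` variables is contained in the scope of some
constraint, and any two constraints have the same projection to every tuple of at most `m` variables
which are in both scopes. -/
def IsMinimal (I : Instance V B) (m n : ℕ) : Prop :=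
  (∀ W : Finset V, W.card ≤ n → ∃ C ∈ I.constraints, (W : Set V) ⊆ C.scope) ∧
    ∀ k ≤ m, ∀ t : Fin k → V, ∀ C ∈ I.constraints, ∀ D ∈ I.constraints,
      ∀ (hC : ∀ i, t i ∈ C.scope) (hD : ∀ i, t i ∈ D.scope),
        C.proj (fun i => ⟨t i, hC i⟩) = D.proj (fun i => ⟨t i, hD i⟩)

/-- The projection of the instance to the tuple `t`, i.e. the projection to `t` of a
constraint whose scope contains `t`.  (For minimal instances, all these constraints have the same
projection.) -/
def proj (I : Instance V B) {k : ℕ} (t : Fin k → V) : Set (Fin k → B) :=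
  {a | ∃ C ∈ I.constraints, ∃ hC : ∀ i, t i ∈ C.scope, a ∈ C.proj (fun i => ⟨t i, hC i⟩)}

/-- The projection of the instance to the single variable `y`. -/
def projVar (I : Instance V B) (y : V) : Set B :=
  {b | ∃ C ∈ I.constraints, ∃ hy : y ∈ C.scope, ∃ f ∈ C.maps, f ⟨y, hy⟩ = b}

/-- One step of a path: some constraint contains both variables in its scope and allows both values
at the same time. -/
def Step (I : Instance V B) (p q : V × B) : Prop :=
  ∃ C ∈ I.constraints, ∃ (hp : p.1 ∈ C.scope) (hq : q.1 ∈ C.scope),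
    ∃ f ∈ C.maps, f ⟨p.1, hp⟩ = p.2 ∧ f ⟨q.1, hq⟩ = q.2

/-- The linkedness congruence on the projection of the instance to the variable `y`: the values `a`
and `b` are connected by a path (of at least one step) from `y` to `y`. -/
def Linked (I : Instance V B) (y : V) (a b : B) : Prop :=
  Relation.TransGen I.Step (y, a) (y, b)

/-- The restriction of the instance to a set `S` of variables. -/
def restrict (I : Instance V B) (S : Set V) : Instance S B where
  constraints := {D | ∃ C ∈ I.constraints,
    D = { scope := {y : S | (y : V) ∈ C.scope}
          maps := {g | ∃ f ∈ C.maps, ∀ y, g y = f ⟨y.1.1, y.2⟩} }}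

variable {ℓ : ℕ} {H : Type u} [(hyperLang ℓ).Structure H]

/-- The injectivisation of an instance over the set of orbits of `ℓ`-tuples: all maps with a value
that is not an injective orbit are removed from the constraints. -/
def injectivisation (J : Instance V (Orbit ℓ H)) : Instance V (Orbit ℓ H) where
  constraints := {D | ∃ C ∈ J.constraints,
    D = { scope := C.scope
          maps := {g | g ∈ C.maps ∧ ∀ y, IsInjOrbit (g y)} }}

/-- The finitisation of an instance over `H`.  Its variables are the (strictly) increasing
`ℓ`-tuples of variables, its domain is the set of orbits of `ℓ`-tuples. -/
def finitisation (ℓ : ℕ) [(hyperLang ℓ).Structure H] [LinearOrder V] (I : Instance V H) :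
    Instance (Fin ℓ ↪o V) (Orbit ℓ H) where
  constraints := {D | ∃ C ∈ I.constraints,
    D = { scope := {t | ∀ i, t i ∈ C.scope}
          maps := {g | ∃ f ∈ C.maps, ∀ t, orbitOf (fun i => f ⟨t.1 i, t.2 i⟩) = g t} }}

/-- Inj-irreducibility (with respect to `p₁`) of an instance over `H`. -/
def IsInjIrreducible (ℓ : ℕ) [(hyperLang ℓ).Structure H] [LinearOrder H] [LinearOrder V]
    (p₁ : (Fin 2 → H) → H) (I : Instance V H) : Prop :=
  I.IsNontrivial ∧ I.IsMinimal ℓ ℓ ∧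
    ∀ S : Set (Fin ℓ ↪o V),
      (∃ g, ((I.finitisation ℓ).restrict S).injectivisation.IsSolution g) ∨
      (∃ y : S, ∃ O₁ O₂ : Orbit ℓ H, IsE O₁ ∧ IsN O₂ ∧
        O₁ ∈ ((I.finitisation ℓ).restrict S).projVar y ∧
        O₂ ∈ ((I.finitisation ℓ).restrict S).projVar y ∧
        ¬ ((I.finitisation ℓ).restrict S).Linked y O₁ O₂) ∨
      (∃ y : S, ∃ O₁ O₂ : Orbit ℓ H, IsInjOrbit O₁ ∧ IsNonDeterministic p₁ O₂ ∧
        ((I.finitisation ℓ).restrict S).Linked y O₁ O₂)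

end Instance

end HypergraphCSP

open HypergraphCSP FirstOrder CategoryTheory

/-! Applying the injective `p₁` repeatedly shows that every constraint contains an injective map. By
homogeneity of the hypergraph, such a map matters only through the 0/1 edge values it gives to the
increasing `ℓ`-tuples of its scope. The linear symmetry makes the set of these value assignments an
affine space over `ZMod 2` (`Instance.add_mem_edgeAssignments`), so it is cut out by its minimal
equations, the inclusion-minimal sets of coordinates with constant sum (`mem_of_minSumConstOn`). The
problem becomes a linear system in the edge values.

Call two tuples adjacent if they share a minimal equation of some constraint. The system splits
along connected components, and inj-irreducibility is applied with each component as `S`. If `E` and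
`N` are linked nowhere in it, propagating one value from one tuple solves its equations
(`Instance.exists_solution_of_not_linksInj`). Otherwise they are linked at every tuple
(`Instance.LinksInj.of_mem_component`), which excludes (ii). Alternative (iii) fails because
non-determinism spreads to the whole support of a minimal equation
(`Instance.isNonDeterministic_of_minSumConstOn`): otherwise `p₁` would produce a shorter equation.
Hence paths within the component never join a non-deterministic orbit to an injective one, and (i)
provides the solution.

The glued solution turns the variable set into a hypergraph. A forbidden hypergraph in it would fit
into the scope of one constraint, where the values are realised in `H`. So it lies in `K` and embeds
into `H`; homogeneity identifies this embedding on each scope with a map of the constraint. -/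

namespace HypergraphCSP

open FirstOrder.Language Structure

/-! ### Extending finite partial isomorphisms to automorphisms -/

section Homogeneity

/-- A family of elements of an ultrahomogeneous relational structure can be moved by an
automorphism to any finite family of the same isomorphism type. -/
theorem exists_equiv_of_isUltrahomogeneous {L : FirstOrder.Language} [L.IsRelational] {M : Type*}
    [L.Structure M] (h : L.IsUltrahomogeneous M) {ι : Type*} [Finite ι] (a b : ι → M)
    (hab : ∀ i j, a i = a j ↔ b i = b j)
    (hR : ∀ (n : ℕ) (R : L.Relations n) (s : Fin n → ι), RelMap R (a ∘ s) ↔ RelMap R (b ∘ s)) :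
    ∃ α : M ≃[L] M, ∀ i, α (a i) = b i := by
  let S : L.Substructure M := ⟨Set.range a, fun f => isEmptyElim f⟩
  have hS : ∀ y : S, ∃ i, a i = y := fun y => y.2
  choose c hc using hS
  have : Finite S := Set.finite_range a
  let f : S ↪[L] M :=
    { toFun := fun y => b (c y)
      inj' := fun y z hyz => Subtype.ext (by
        rw [← hc y, ← hc z]; exact (hab _ _).2 hyz)
      map_fun' := fun f => isEmptyElim f
      map_rel' := fun {n} R t => by
        have : (fun i => ((t i : S) : M)) = a ∘ (c ∘ t) := by
          funext i; exact (hc _).symm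
        change RelMap R (b ∘ (c ∘ t)) ↔ RelMap R (fun i => ((t i : S) : M))
        rw [this]; exact (hR n R _).symm }
  obtain ⟨g, hg⟩ := h S Substructure.FG.of_finite f
  refine ⟨g, fun i => ?_⟩
  have h1 : g (a i) = f ⟨a i, i, rfl⟩ := (DFunLike.congr_fun hg (⟨a i, i, rfl⟩ : S)).symm
  rw [h1]
  exact (hab _ _).1 (hc _)

end Homogeneity

/-! ### Ordered expansions in terms of edges and order -/

section OrderedStructures

variable {ℓ : ℕ}

/-- The `hyperLang ℓ`-structure whose hyperedges are the tuples satisfying `E`. -/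
@[reducible] def structureOfEdges {M : Type*} (E : (Fin ℓ → M) → Prop) :
    (hyperLang ℓ).Structure M where
  funMap := fun f => isEmptyElim f
  RelMap := fun {_} r => match r with
    | .edge => E

theorem hyperStructure_ext {M : Type*} {h h' : (hyperLang ℓ).Structure M}
    (hE : ∀ a : Fin ℓ → M, @IsEdge ℓ M h a ↔ @IsEdge ℓ M h' a) : h = h' := by
  refine Structure.ext ?_ ?_
  · funext n f; exact isEmptyElim f
  · funext n r a
    cases r
    exact propext (hE a)

theorem orderedStructure_left_injective {M : Type*} {h h' : (hyperLang ℓ).Structure M}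
    {lo lo' : LinearOrder M} (e : orderedStructure h lo = orderedStructure h' lo') : h = h' := by
  refine hyperStructure_ext fun a => ?_
  have : @RelMap (orderedLang ℓ) M (orderedStructure h lo) ℓ (Sum.inl EdgeSymbol.edge) a ↔
      @RelMap (orderedLang ℓ) M (orderedStructure h' lo') ℓ (Sum.inl EdgeSymbol.edge) a := by
    rw [e]
  exact this

theorem orderedStructure_relMap_iff {M N ι : Type*} (h : (hyperLang ℓ).Structure M)
    (lo : LinearOrder M) (h' : (hyperLang ℓ).Structure N) (lo' : LinearOrder N) (a : ι → M)
    (b : ι → N) :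
    (∀ (n : ℕ) (R : (orderedLang ℓ).Relations n) (s : Fin n → ι),
      @RelMap (orderedLang ℓ) M (orderedStructure h lo) n R (a ∘ s) ↔
        @RelMap (orderedLang ℓ) N (orderedStructure h' lo') n R (b ∘ s)) ↔
    (∀ i j, a i ≤ a j ↔ b i ≤ b j) ∧
      ∀ s : Fin ℓ → ι, IsEdge (a ∘ s) ↔ IsEdge (b ∘ s) := by
  constructor
  · intro H
    exact ⟨fun i j => H 2 (Sum.inr orderRel.le) ![i, j], fun s => H ℓ (Sum.inl .edge) s⟩
  · rintro ⟨H₁, H₂⟩ n (R | R) s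
    · cases R
      exact H₂ s
    · cases R
      exact H₁ (s 0) (s 1)

theorem exists_orderedEmbedding_iff {M N : Type*} (h : (hyperLang ℓ).Structure M)
    (lo : LinearOrder M) (h' : (hyperLang ℓ).Structure N) (lo' : LinearOrder N) :
    Nonempty (@Language.Embedding (orderedLang ℓ) M N (orderedStructure h lo)
      (orderedStructure h' lo')) ↔
      ∃ j : M → N, StrictMono j ∧ ∀ s : Fin ℓ → M, IsEdge (j ∘ s) ↔ IsEdge s := by
  let := orderedStructure h lo
  let := orderedStructure h' lo'
  constructor
  · rintro ⟨e⟩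
    have := (orderedStructure_relMap_iff h lo h' lo' id e).1
      (fun n R s => (e.map_rel R s).symm)
    exact ⟨e, (Monotone.strictMono_of_injective (fun x y hxy => (this.1 x y).1 hxy) e.injective),
      fun s => (this.2 s).symm⟩
  · rintro ⟨j, hj, hE⟩
    have := (orderedStructure_relMap_iff h lo h' lo' id j).2
      ⟨fun x y => hj.le_iff_le.symm, fun s => (hE s).symm⟩
    exact ⟨{ toFun := j
             inj' := hj.injective
             map_fun' := fun f => isEmptyElim f
             map_rel' := fun {n} R s => (this n R s).symm }⟩

end OrderedStructures

/-! ### Invariance under automorphisms -/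

section Invariance

variable {ℓ : ℕ} {H : Type u} [(hyperLang ℓ).Structure H]

theorem isEdge_map_iff (α : H ≃[hyperLang ℓ] H) (a : Fin ℓ → H) :
    IsEdge (fun i => α (a i)) ↔ IsEdge a :=
  α.map_rel EdgeSymbol.edge a

/-- A definable relation is invariant under automorphisms. -/
theorem relMap_equiv_iff {LA : FirstOrder.Language.{v, w}} [LA.Structure H]
    (hA : IsFirstOrderReduct ℓ LA H) {k : ℕ} (R : LA.Relations k) (α : H ≃[hyperLang ℓ] H)
    (a : Fin k → H) : RelMap R (fun i => α (a i)) ↔ RelMap R a := by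
  obtain ⟨φ, hφ⟩ := Set.empty_definable_iff.1 (hA k R)
  have h := fun a : Fin k → H => Set.ext_iff.1 hφ a
  exact (h _).trans ((StrongHomClass.realize_formula α φ).trans (h a).symm)

end Invariance

/-! ### Age and homogeneity of the limit and of its hypergraph reduct -/

section FraisseLimit

variable {ℓ : ℕ} {K : Set (Bundled.{u} (hyperLang ℓ).Structure)}
  {H : Type u} [Countable H] [hs : (hyperLang ℓ).Structure H] [lo : LinearOrder H]

/-- Pulling the order of `H` back along `j` puts the ordered `M` into the age. Membership in
`orderedClass K` only supplies some hypergraph structure, which `orderedStructure_left_injective`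
identifies with `h`. -/
theorem IsOrderedFraisseLimit.mem_of_embeds (hH : IsOrderedFraisseLimit K H) {M : Type u}
    [Finite M] (h : (hyperLang ℓ).Structure M) {j : M → H} (hj : Function.Injective j)
    (hE : ∀ s : Fin ℓ → M, IsEdge (j ∘ s) ↔ IsEdge s) : (⟨M, h⟩ : Bundled _) ∈ K := by
  let loM : LinearOrder M := LinearOrder.lift' j hj
  let := orderedStructure hs lo
  let := orderedStructure h loM
  have hjm : StrictMono j := fun x y hxy => hxy
  have hmem : (⟨M, orderedStructure h loM⟩ : Bundled (orderedLang ℓ).Structure) ∈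
      (orderedLang ℓ).age H :=
    ⟨Structure.FG.of_finite, (exists_orderedEmbedding_iff h loM hs lo).2 ⟨j, hjm, hE⟩⟩
  rw [IsFraisseLimit.age hH] at hmem
  obtain ⟨h', lo', hK, he⟩ := hmem
  have := orderedStructure_left_injective (h := h) (lo := loM) (h' := h') (lo' := lo') he
  subst this
  exact hK

theorem IsOrderedFraisseLimit.exists_strictMono (hH : IsOrderedFraisseLimit K H) {M : Type u}
    [h : (hyperLang ℓ).Structure M] [loM : LinearOrder M] (hM : (⟨M, h⟩ : Bundled _) ∈ K) :
    ∃ j : M → H, StrictMono j ∧ ∀ s : Fin ℓ → M, IsEdge (j ∘ s) ↔ IsEdge s := by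
  let := orderedStructure hs lo
  have hmem : (⟨M, orderedStructure h loM⟩ : Bundled (orderedLang ℓ).Structure) ∈
      orderedClass K := ⟨h, loM, hM, rfl⟩
  rw [← IsFraisseLimit.age hH] at hmem
  exact (exists_orderedEmbedding_iff h loM hs lo).1 hmem.2

theorem IsOrderedFraisseLimit.exists_orderedEquiv (hH : IsOrderedFraisseLimit K H) {ι : Type*}
    [Finite ι] (a b : ι → H) (hlt : ∀ i j, a i ≤ a j ↔ b i ≤ b j)
    (hE : ∀ s : Fin ℓ → ι, IsEdge (a ∘ s) ↔ IsEdge (b ∘ s)) :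
    ∃ α : H ≃[hyperLang ℓ] H, StrictMono α ∧ ∀ i, α (a i) = b i := by
  let := orderedStructure hs lo
  obtain ⟨α, hα⟩ := exists_equiv_of_isUltrahomogeneous (IsFraisseLimit.ultrahomogeneous hH) a b
    (fun i j => by rw [le_antisymm_iff, le_antisymm_iff, hlt, hlt])
    ((orderedStructure_relMap_iff hs lo hs lo a b).2 ⟨hlt, hE⟩)
  have := (orderedStructure_relMap_iff hs lo hs lo id α).1
    (fun n R s => (α.map_rel R s).symm)
  refine ⟨{ toEquiv := α.toEquiv
            map_fun' := fun f => isEmptyElim f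
            map_rel' := fun {n} R s => ?_ }, ?_, hα⟩
  · cases R
    exact (this.2 s).symm
  · exact Monotone.strictMono_of_injective (fun x y hxy => (this.1 x y).1 hxy) α.injective

theorem IsOrderedFraisseLimit.sameOrderedOrbit (hH : IsOrderedFraisseLimit K H) {k : ℕ}
    {a b : Fin k → H} (hlt : ∀ i j, a i ≤ a j ↔ b i ≤ b j)
    (hE : ∀ s : Fin ℓ → Fin k, IsEdge (a ∘ s) ↔ IsEdge (b ∘ s)) : SameOrderedOrbit ℓ a b :=
  hH.exists_orderedEquiv a b hlt hE

/-- Forgetting the order keeps homogeneity because `K` is expanded by all linear orders: in a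
one-point extension, the order on the domain can be chosen to make the given embedding increasing,
which reduces to the ordered limit. -/
theorem IsOrderedFraisseLimit.isUltrahomogeneous (hH : IsOrderedFraisseLimit K H) :
    (hyperLang ℓ).IsUltrahomogeneous H := by
  rw [isUltrahomogeneous_iff_IsExtensionPair Structure.cg_of_countable,
    isExtensionPair_iff_exists_embedding_closure_singleton_sup]
  intro S hS f m
  set T : (hyperLang ℓ).Substructure H := Substructure.closure _ {m} ⊔ S with hT
  have hTS : S ≤ T := le_sup_right
  have : Finite S := hS.finite
  have : Finite T := (Substructure.FG.sup (Substructure.fg_closure_singleton m) hS).finite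
  have hTm : ∀ y ∈ T, y = m ∨ y ∈ S := by
    let T' : (hyperLang ℓ).Substructure H := ⟨insert m S, fun f => isEmptyElim f⟩
    have : T ≤ T' := sup_le (by
      rw [Substructure.closure_le]; rintro _ rfl; exact Set.mem_insert _ _)
      (fun y hy => Set.mem_insert_of_mem _ hy)
    exact fun y hy => this hy
  classical
  -- Order `T` by the images under `f`, with the new point, if there is one, on top.
  let r : T → WithTop H := fun y => if h : (y : H) ∈ S then (f ⟨y, h⟩ : H) else ⊤
  have hr : Function.Injective r := by
    intro y z hyz
    by_cases hy : (y : H) ∈ S <;> by_cases hz : (z : H) ∈ S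
    · simp only [r, hy, hz, dif_pos, WithTop.coe_inj] at hyz
      exact Subtype.ext (congrArg (fun y : S => (y : H)) (f.injective hyz))
    · simp [r, hy, hz] at hyz
    · simp [r, hy, hz] at hyz
    · exact Subtype.ext (((hTm _ y.2).resolve_right hy).trans
        ((hTm _ z.2).resolve_right hz).symm)
  let : LinearOrder T := LinearOrder.lift' r hr
  have hTK : (⟨T, inferInstance⟩ : Bundled (hyperLang ℓ).Structure) ∈ K :=
    hH.mem_of_embeds _ (j := fun y : T => (y : H)) Subtype.val_injective (fun s => Iff.rfl)
  obtain ⟨j, hj, hjE⟩ := hH.exists_strictMono hTK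
  let ι := Substructure.inclusion hTS
  obtain ⟨α, -, hα⟩ := hH.exists_orderedEquiv (fun y : S => j (ι y)) f (fun y z => by
      rw [hj.le_iff_le]
      change r (ι y) ≤ r (ι z) ↔ _
      have h1 : ∀ y : S, r (ι y) = (f y : H) := fun y => dif_pos y.2
      rw [h1, h1, WithTop.coe_le_coe]) (fun s => by
      refine (hjE (ι ∘ s)).trans ?_
      exact (ι.map_rel EdgeSymbol.edge s).trans (f.map_rel EdgeSymbol.edge s).symm)
  refine ⟨⟨⟨fun y => α (j y), α.injective.comp hj.injective⟩, fun f => isEmptyElim f,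
    fun {n} R s => ?_⟩, ?_⟩
  · cases R
    exact (α.map_rel EdgeSymbol.edge (j ∘ s)).trans (hjE s)
  · ext y
    exact (hα y).symm

theorem IsOrderedFraisseLimit.exists_equiv (hH : IsOrderedFraisseLimit K H) {ι : Type*}
    [Finite ι] (a b : ι → H) (hab : ∀ i j, a i = a j ↔ b i = b j)
    (hE : ∀ s : Fin ℓ → ι, IsEdge (a ∘ s) ↔ IsEdge (b ∘ s)) :
    ∃ α : H ≃[hyperLang ℓ] H, ∀ i, α (a i) = b i :=
  exists_equiv_of_isUltrahomogeneous hH.isUltrahomogeneous a b hab fun n R s => by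
    cases R
    exact hE s

/-- Members of `K` live in universe `u` while `ι` need not, hence the quantification over copies `M`
and the use of `Shrink`. -/
theorem IsOrderedFraisseLimit.exists_strictMono_of_equiv (hH : IsOrderedFraisseLimit K H)
    {ι : Type*} [Finite ι] [LinearOrder ι] {E : (Fin ℓ → ι) → Prop}
    (hE : ∀ (M : Type u) (e : M ≃ ι),
      (⟨M, structureOfEdges fun s => E (e ∘ s)⟩ : Bundled (hyperLang ℓ).Structure) ∈ K) :
    ∃ j : ι → H, StrictMono j ∧ ∀ s : Fin ℓ → ι, IsEdge (j ∘ s) ↔ E s := by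
  let e := (equivShrink.{u} ι).symm
  let loM : LinearOrder (Shrink.{u} ι) := LinearOrder.lift' e e.injective
  obtain ⟨j, hj, hjE⟩ := hH.exists_strictMono (h := structureOfEdges fun s => E (e ∘ s))
    (loM := loM) (hE _ e)
  refine ⟨j ∘ e.symm, fun x y hxy => hj ?_, fun s => (hjE (e.symm ∘ s)).trans ?_⟩
  · change e (e.symm x) < e (e.symm y)
    simpa using hxy
  · change E (e ∘ e.symm ∘ s) ↔ E s
    rw [← Function.comp_assoc, Equiv.self_comp_symm, Function.id_comp]

/-- A finite family of elements can be moved by an automorphism so as to become increasing with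
respect to any given order on its index set. -/
theorem IsOrderedFraisseLimit.exists_equiv_strictMono (hH : IsOrderedFraisseLimit K H) {ι : Type*}
    [Finite ι] [LinearOrder ι] {a : ι → H} (ha : Function.Injective a) :
    ∃ α : H ≃[hyperLang ℓ] H, StrictMono fun i => α (a i) := by
  -- `j` realises the hypergraph induced by `a` with the prescribed order; unordered homogeneity
  -- then moves `a` to `j`.
  obtain ⟨j, hj, hjE⟩ := hH.exists_strictMono_of_equiv (ι := ι) (E := fun s => IsEdge (a ∘ s))
    fun M e => by
      have : Finite M := .of_equiv _ e.symm
      exact hH.mem_of_embeds (structureOfEdges fun s => IsEdge (a ∘ e ∘ s)) (j := a ∘ e)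
        (ha.comp e.injective) fun s => Iff.rfl
  obtain ⟨α, hα⟩ := hH.exists_equiv a j
    (fun x y => by rw [ha.eq_iff, hj.injective.eq_iff]) (fun s => (hjE s).symm)
  exact ⟨α, by simpa only [hα] using hj⟩

/-- The hypergraph axioms concern one tuple at a time, and its range is a finite substructure, hence
in `K`. -/
theorem IsOrderedFraisseLimit.isHypergraph (hH : IsOrderedFraisseLimit K H)
    (hK : ∀ M ∈ K, IsHypergraph ℓ M) : IsHypergraph ℓ H := by
  have key : ∀ a : Fin ℓ → H, ∃ _ : (hyperLang ℓ).Structure (Set.range a),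
      IsHypergraph ℓ (Set.range a) ∧
      ∀ s : Fin ℓ → Set.range a, IsEdge s ↔ IsEdge fun i => (s i : H) := fun a =>
    ⟨structureOfEdges fun s => IsEdge fun i => (s i : H),
      hK _ (hH.mem_of_embeds (M := Set.range a) (structureOfEdges fun s => IsEdge fun i => (s i : H))
        (j := Subtype.val) Subtype.val_injective fun s => Iff.rfl), fun s => Iff.rfl⟩
  constructor
  · intro a ha
    obtain ⟨h, hM, hE⟩ := key a
    intro i j hij
    exact hM.1 (fun i => ⟨a i, i, rfl⟩) ((hE _).2 ha) (Subtype.ext hij)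
  · intro a σ ha
    obtain ⟨h, hM, hE⟩ := key a
    exact (hE _).1 (hM.2 (fun i => ⟨a i, i, rfl⟩) σ ((hE _).2 ha))

end FraisseLimit

/-! ### Affine spaces over the two-element field and their minimal equations -/

section Affine

variable {X : Type*}

/-- The sum of the coordinates in `T` is constant on `A`. -/
def SumConstOn (A : Set (X → ZMod 2)) (T : Finset X) : Prop :=
  ∀ x ∈ A, ∀ y ∈ A, ∑ t ∈ T, x t = ∑ t ∈ T, y t

/-- `T` is a minimal non-empty set of coordinates whose sum is constant on `A`. -/
structure MinSumConstOn (A : Set (X → ZMod 2)) (T : Finset X) : Prop where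
  nonempty : T.Nonempty
  const : SumConstOn A T
  not_const : ∀ T' ⊂ T, T'.Nonempty → ¬ SumConstOn A T'

/-- A non-minimal equation `T` contains a smaller one `T'`, and then `T \ T'` is an equation too;
induct on both pieces. -/
theorem sum_eq_of_minSumConstOn {A : Set (X → ZMod 2)} {g x₀ : X → ZMod 2} (hx₀ : x₀ ∈ A)
    (hg : ∀ T, MinSumConstOn A T → ∃ x ∈ A, ∑ t ∈ T, g t = ∑ t ∈ T, x t) (T : Finset X)
    (hT : SumConstOn A T) : ∑ t ∈ T, g t = ∑ t ∈ T, x₀ t := by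
  classical
  induction T using Finset.strongInduction with
  | H T ih =>
    by_cases hmin : MinSumConstOn A T
    · obtain ⟨x, hx, h⟩ := hg T hmin
      rw [h, hT x hx x₀ hx₀]
    rcases T.eq_empty_or_nonempty with rfl | hne
    · simp
    have : ∃ T' ⊂ T, T'.Nonempty ∧ SumConstOn A T' := by
      by_contra! h
      exact hmin ⟨hne, hT, h⟩
    obtain ⟨T', hT', hne', hc⟩ := this
    have hc' : SumConstOn A (T \ T') := fun x hx y hy => by
      have h1 := hT x hx y hy
      rw [← Finset.sum_sdiff hT'.1, ← Finset.sum_sdiff (f := y) hT'.1, hc x hx y hy] at h1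
      exact add_right_cancel h1
    rw [← Finset.sum_sdiff hT'.1, ← Finset.sum_sdiff (f := x₀) hT'.1, ih T' hT' hc,
      ih _ (Finset.sdiff_ssubset hT'.1 hne') hc']

/-- A non-empty affine subspace of `(ZMod 2) ^ X` is the solution set of its minimal equations. -/
theorem mem_of_minSumConstOn [Finite X] {A : Set (X → ZMod 2)} (hne : A.Nonempty)
    (hA : ∀ x ∈ A, ∀ y ∈ A, ∀ z ∈ A, x + y + z ∈ A) {g : X → ZMod 2}
    (hg : ∀ T, MinSumConstOn A T → ∃ x ∈ A, ∑ t ∈ T, g t = ∑ t ∈ T, x t) : g ∈ A := by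
  classical
  have := Fintype.ofFinite X
  obtain ⟨x₀, hx₀⟩ := hne
  have h2 : ∀ x : X → ZMod 2, x + x = 0 := fun x =>
    funext fun t => CharTwo.add_self_eq_zero (x t)
  -- The direction space of `A`; it is closed under addition because `A` is closed under `x + x₀ +
  -- z`.
  let D : Submodule (ZMod 2) (X → ZMod 2) :=
    { carrier := {d | x₀ + d ∈ A}
      zero_mem' := by simpa using hx₀
      add_mem' := fun {d e} hd he => by
        have := hA _ hd _ hx₀ _ he
        have h3 : x₀ + d + x₀ + (x₀ + e) = x₀ + (d + e) := by
          linear_combination h2 x₀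
        rwa [h3] at this
      smul_mem' := fun c d hd => by
        have : c = 0 ∨ c = 1 := by revert c; decide
        rcases this with rfl | rfl
        · simpa using hx₀
        · simpa using hd }
  by_contra hgA
  have hgD : g + x₀ ∉ D := fun h => hgA (by
    have h3 : x₀ + (g + x₀) = g := by linear_combination h2 x₀
    have h4 : x₀ + (g + x₀) ∈ A := h
    rwa [h3] at h4)
  -- A functional vanishing on the directions but not at `g + x₀`. Over `ZMod 2` it is a sum over a
  -- set of coordinates, hence an equation of `A` that `g` would violate.
  obtain ⟨φ, hφ, hD⟩ := Submodule.exists_le_ker_of_notMem hgD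
  let T : Finset X := Finset.univ.filter fun t => φ (Pi.single t 1) = 1
  have hφT : ∀ y, φ y = ∑ t ∈ T, y t := fun y => by
    rw [LinearMap.pi_apply_eq_sum_univ φ y, Finset.sum_filter]
    refine Finset.sum_congr rfl fun t _ => ?_
    have : (fun j => if t = j then (1 : ZMod 2) else 0) = Pi.single t 1 := by
      funext j; simp [Pi.single_apply, eq_comm]
    rw [this]
    generalize φ (Pi.single t 1) = c
    generalize y t = d
    revert c d
    decide
  have hconst : ∀ x ∈ A, φ x = φ x₀ := fun x hx => by
    have h3 : x + x₀ ∈ D := by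
      change x₀ + (x + x₀) ∈ A
      have : x₀ + (x + x₀) = x := by linear_combination h2 x₀
      rwa [this]
    have h4 : φ x + φ x₀ = 0 := by rw [← map_add]; exact hD h3
    exact CharTwo.add_eq_zero.1 h4
  have h5 := sum_eq_of_minSumConstOn hx₀ hg T fun x hx y hy => by
    rw [← hφT, ← hφT, hconst x hx, hconst y hy]
  rw [← hφT, ← hφT] at h5
  exact hφ (by rw [map_add, h5]; exact CharTwo.add_self_eq_zero _)

end Affine

/-! ### Edge values and injective orbits -/

section EdgeValue

variable {ℓ : ℕ} {H : Type u} [(hyperLang ℓ).Structure H]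

open Classical in
/-- The indicator of the hyperedge relation. -/
noncomputable def edgeValue (a : Fin ℓ → H) : ZMod 2 := if IsEdge a then 1 else 0

theorem edgeValue_eq_iff {a b : Fin ℓ → H} :
    edgeValue a = edgeValue b ↔ (IsEdge a ↔ IsEdge b) := by
  unfold edgeValue
  by_cases ha : IsEdge a <;> by_cases hb : IsEdge b <;> simp [ha, hb]

theorem edgeValue_eq_one_iff {a : Fin ℓ → H} : edgeValue a = 1 ↔ IsEdge a := by
  unfold edgeValue
  by_cases ha : IsEdge a <;> simp [ha]

theorem SameOrbit.isEdge_iff {a b : Fin ℓ → H} (h : SameOrbit ℓ a b) : IsEdge a ↔ IsEdge b := by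
  obtain ⟨α, hα⟩ := h
  rw [← isEdge_map_iff α a, show (fun i => α (a i)) = b from funext hα]

theorem SameOrbit.injective {a b : Fin ℓ → H} (h : SameOrbit ℓ a b) (ha : Function.Injective a) :
    Function.Injective b := by
  obtain ⟨α, hα⟩ := h
  rw [← show (fun i => α (a i)) = b from funext hα]
  exact α.injective.comp ha

theorem SameOrderedOrbit.sameOrbit [LinearOrder H] {k : ℕ} {a b : Fin k → H}
    (h : SameOrderedOrbit ℓ a b) : SameOrbit ℓ a b := by
  obtain ⟨α, -, hα⟩ := h
  exact ⟨α, hα⟩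

theorem SameOrderedOrbit.refl [LinearOrder H] {k : ℕ} (a : Fin k → H) :
    SameOrderedOrbit ℓ a a :=
  ⟨Language.Equiv.refl _ _, strictMono_id, fun _ => rfl⟩

theorem orbitOf_eq_iff {a b : Fin ℓ → H} : orbitOf a = orbitOf b ↔ SameOrbit ℓ a b :=
  Quotient.eq (r := orbitSetoid ℓ H)

theorem isE_orbitOf_iff {a : Fin ℓ → H} :
    IsE (orbitOf a) ↔ Function.Injective a ∧ IsEdge a := by
  constructor
  · rintro ⟨b, hb, hinj, hE⟩
    have h := orbitOf_eq_iff.1 hb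
    exact ⟨h.injective hinj, h.isEdge_iff.1 hE⟩
  · rintro ⟨h1, h2⟩
    exact ⟨a, rfl, h1, h2⟩

theorem isN_orbitOf_iff {a : Fin ℓ → H} :
    IsN (orbitOf a) ↔ Function.Injective a ∧ ¬ IsEdge a := by
  constructor
  · rintro ⟨b, hb, hinj, hE⟩
    have h := orbitOf_eq_iff.1 hb
    exact ⟨h.injective hinj, fun h' => hE (h.isEdge_iff.2 h')⟩
  · rintro ⟨h1, h2⟩
    exact ⟨a, rfl, h1, h2⟩

theorem isInjOrbit_orbitOf_iff {a : Fin ℓ → H} :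
    IsInjOrbit (orbitOf a) ↔ Function.Injective a := by
  rw [IsInjOrbit, isE_orbitOf_iff, isN_orbitOf_iff]
  tauto

theorem IsHypergraph.isEdge_comp_perm (hH : IsHypergraph ℓ H) (a : Fin ℓ → H)
    (σ : Equiv.Perm (Fin ℓ)) : IsEdge (a ∘ σ) ↔ IsEdge a :=
  ⟨fun h => by
    have := hH.2 _ σ.symm h
    rwa [Function.comp_assoc, Equiv.self_comp_symm] at this, hH.2 a σ⟩

theorem IsHypergraph.isEdge_comp_iff (hH : IsHypergraph ℓ H) {a b : Fin ℓ → H}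
    (h : IsEdge a ↔ IsEdge b) (s : Fin ℓ → Fin ℓ) : IsEdge (a ∘ s) ↔ IsEdge (b ∘ s) := by
  by_cases hs : Function.Injective s
  · obtain ⟨σ, rfl⟩ : ∃ σ : Equiv.Perm (Fin ℓ), σ = s :=
      ⟨Equiv.ofBijective s (Finite.injective_iff_bijective.1 hs), rfl⟩
    rw [hH.isEdge_comp_perm, hH.isEdge_comp_perm, h]
  · exact iff_of_false (fun h => hs (hH.1 _ h).of_comp) fun h => hs (hH.1 _ h).of_comp

end EdgeValue

/-! ### The operation `p₁` and determinism -/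

section LexFirstProjection

variable {ℓ : ℕ} {H : Type u} [(hyperLang ℓ).Structure H] [LinearOrder H]
  {LA : FirstOrder.Language.{v, w}} [LA.Structure H] {p₁ : (Fin 2 → H) → H}

theorem IsLexFirstProjection.strictMono_apply (hp : IsLexFirstProjection ℓ LA p₁)
    {ι : Type*} [Preorder ι]
    (a : ι → H) {e : ι → H} (he : StrictMono e) : StrictMono fun i => p₁ ![a i, e i] :=
  fun _ _ hij => hp.2.2.2.2 _ _ _ _ (Or.inl (he hij))

theorem IsLexFirstProjection.edgeValue_apply_of_injective (hp : IsLexFirstProjection ℓ LA p₁)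
    {a e : Fin ℓ → H}
    (ha : Function.Injective a) (he : Function.Injective e) :
    edgeValue (fun i => p₁ ![a i, e i]) = edgeValue a :=
  edgeValue_eq_iff.2 (hp.2.2.2.1 a e ha he).isEdge_iff

/-- Covers two cases: on injective orbits `p₁` is the first projection, and on deterministic ones
`α` comes from the definition. -/
theorem IsLexFirstProjection.exists_equiv_edgeValue_eq (hp : IsLexFirstProjection ℓ LA p₁)
    {a : Fin ℓ → H}
    (ha : ¬ IsNonDeterministic p₁ (orbitOf a)) :
    ∃ α : H ≃[hyperLang ℓ] H, ∀ e n : Fin ℓ → H, StrictMono e → IsEdge e → StrictMono n →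
      ¬ IsEdge n →
      edgeValue (fun i => p₁ ![α (a i), e i]) = edgeValue (fun i => p₁ ![α (a i), n i]) := by
  by_cases hinj : Function.Injective a
  · refine ⟨Language.Equiv.refl _ _, fun e n he _ hn _ => ?_⟩
    exact (hp.edgeValue_apply_of_injective hinj he.injective).trans
      (hp.edgeValue_apply_of_injective hinj hn.injective).symm
  · have hdet : IsDeterministic p₁ (orbitOf a) := by
      by_contra h
      exact ha ⟨fun h' => hinj (isInjOrbit_orbitOf_iff.1 h'), h⟩
    obtain ⟨α, hα⟩ := hdet.2 a rfl
    exact ⟨α, fun e n he hE hn hN =>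
      edgeValue_eq_iff.2 (hα e n he hE hn hN).sameOrbit.isEdge_iff⟩

end LexFirstProjection

/-! ### Canonical operations acting on edge values -/

section FraisseLimit

variable {ℓ : ℕ} {K : Set (Bundled.{u} (hyperLang ℓ).Structure)}
  {H : Type u} [Countable H] [(hyperLang ℓ).Structure H] [LinearOrder H]

theorem IsOrderedFraisseLimit.sameOrderedOrbit_of_strictMono (hH : IsOrderedFraisseLimit K H)
    (hhyp : IsHypergraph ℓ H) {a b : Fin ℓ → H} (ha : StrictMono a) (hb : StrictMono b)
    (h : IsEdge a ↔ IsEdge b) : SameOrderedOrbit ℓ a b :=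
  hH.sameOrderedOrbit (fun i j => by rw [ha.le_iff_le, hb.le_iff_le])
    (hhyp.isEdge_comp_iff h)

theorem IsOrderedFraisseLimit.sameOrbit_of_injective (hH : IsOrderedFraisseLimit K H)
    (hhyp : IsHypergraph ℓ H) {a b : Fin ℓ → H} (ha : Function.Injective a)
    (hb : Function.Injective b) (h : IsEdge a ↔ IsEdge b) : SameOrbit ℓ a b :=
  hH.exists_equiv a b (fun i j => by rw [ha.eq_iff, hb.eq_iff]) (hhyp.isEdge_comp_iff h)

/-- A linear symmetry adds up the edge values of increasing tuples. -/
theorem IsInjectiveLinearSymmetry.edgeValue_apply {LA : FirstOrder.Language.{v, w}}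
    [LA.Structure H] {m : (Fin 3 → H) → H} (hm : IsInjectiveLinearSymmetry ℓ LA m)
    (hH : IsOrderedFraisseLimit K H) (hhyp : IsHypergraph ℓ H) {a b c : Fin ℓ → H}
    (ha : StrictMono a) (hb : StrictMono b) (hc : StrictMono c) :
    edgeValue (fun i => m ![a i, b i, c i]) = edgeValue a + edgeValue b + edgeValue c := by
  obtain ⟨-, -, hcan, hmin⟩ := hm
  have hcan' : ∀ a b c a' b' c' : Fin ℓ → H, SameOrderedOrbit ℓ a a' → SameOrderedOrbit ℓ b b' →
      SameOrderedOrbit ℓ c c' → edgeValue (fun i => m ![a i, b i, c i]) =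
        edgeValue (fun i => m ![a' i, b' i, c' i]) := by
    intro a b c a' b' c' h1 h2 h3
    have h := hcan ℓ ![a, b, c] ![a', b', c'] (by
      intro i; fin_cases i <;> assumption)
    have e : ∀ a b c : Fin ℓ → H, (fun j => m fun i => ![a, b, c] i j) =
        fun i => m ![a i, b i, c i] := fun a b c => by
      funext j; congr 1; funext i; fin_cases i <;> rfl
    rw [e, e] at h
    exact edgeValue_eq_iff.2 h.sameOrbit.isEdge_iff
  have hS := fun {a b : Fin ℓ → H} (ha : StrictMono a) (hb : StrictMono b) h =>
    hH.sameOrderedOrbit_of_strictMono hhyp (a := a) (b := b) ha hb (edgeValue_eq_iff.1 h)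
  have hR := fun a : Fin ℓ → H => SameOrderedOrbit.refl (ℓ := ℓ) a
  -- Two of three bits agree. Canonicity allows one of the corresponding tuples to be replaced by
  -- the other, and the minority identities apply.
  have h3 : ∀ p q r : ZMod 2, p = q ∨ p = r ∨ q = r := by decide
  rcases h3 (edgeValue a) (edgeValue b) (edgeValue c) with h | h | h
  · rw [hcan' a b c a a c (hR a) (hS hb ha h.symm) (hR c), h, CharTwo.add_self_eq_zero, zero_add]
    exact edgeValue_eq_iff.2 (hmin a c ha.injective hc.injective).1.isEdge_iff
  · rw [hcan' a b c a b a (hR a) (hR b) (hS hc ha h.symm), h, add_right_comm,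
      CharTwo.add_self_eq_zero, zero_add]
    exact edgeValue_eq_iff.2 (hmin a b ha.injective hb.injective).2.1.isEdge_iff
  · rw [hcan' a b c a b b (hR a) (hR b) (hS hc hb h.symm), h, add_assoc,
      CharTwo.add_self_eq_zero, add_zero]
    exact edgeValue_eq_iff.2 (hmin b a hb.injective ha.injective).2.2.isEdge_iff

namespace IsLexFirstProjection

variable {LA : FirstOrder.Language.{v, w}} [LA.Structure H] {p₁ : (Fin 2 → H) → H}

/-- On increasing second arguments, the edge value of `p₁` is a function of the edge value of the
second argument. -/
theorem exists_edgeValue_apply (hp : IsLexFirstProjection ℓ LA p₁)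
    (hH : IsOrderedFraisseLimit K H) (hhyp : IsHypergraph ℓ H) (a : Fin ℓ → H) :
    ∃ φ : ZMod 2 → ZMod 2, ∀ e : Fin ℓ → H, StrictMono e →
      edgeValue (fun i => p₁ ![a i, e i]) = φ (edgeValue e) := by
  have hfac : Function.FactorsThrough
      (fun e : {e : Fin ℓ → H // StrictMono e} => edgeValue fun i => p₁ ![a i, e.1 i])
      (fun e => edgeValue e.1) := by
    rintro ⟨e, he⟩ ⟨e', he'⟩ h
    have h' := hp.2.2.1 ℓ ![a, e] ![a, e'] (by
      intro i
      fin_cases i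
      · exact SameOrderedOrbit.refl a
      · exact hH.sameOrderedOrbit_of_strictMono hhyp he he' (edgeValue_eq_iff.1 h))
    have e : ∀ a b : Fin ℓ → H, (fun j => p₁ fun i => ![a, b] i j) =
        fun i => p₁ ![a i, b i] := fun a b => by
      funext j; congr 1; funext i; fin_cases i <;> rfl
    rw [e, e] at h'
    exact edgeValue_eq_iff.2 h'.sameOrbit.isEdge_iff
  exact ⟨Function.extend (fun e : {e : Fin ℓ → H // StrictMono e} => edgeValue e.1) _ 0,
    fun e he => (hfac.extend_apply 0 ⟨e, he⟩).symm⟩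

/-- Determinism quantifies over all representatives, but an `α` that works for one yields `α.comp β`
for the others, so it fails here for every `α`. The results of `p₁` are increasing, so different
ordered orbits have different edge values. -/
theorem exists_edgeValue_ne (hp : IsLexFirstProjection ℓ LA p₁)
    (hH : IsOrderedFraisseLimit K H) (hhyp : IsHypergraph ℓ H) {a : Fin ℓ → H}
    (ha : IsNonDeterministic p₁ (orbitOf a)) (α : H ≃[hyperLang ℓ] H) :
    ∃ e n : Fin ℓ → H, StrictMono e ∧ IsEdge e ∧ StrictMono n ∧ ¬ IsEdge n ∧
      edgeValue (fun i => p₁ ![α (a i), e i]) ≠ edgeValue (fun i => p₁ ![α (a i), n i]) := by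
  by_contra! hcon
  refine ha.2 ⟨ha.1, fun a' ha' => ?_⟩
  obtain ⟨β, hβ⟩ := orbitOf_eq_iff.1 ha'
  refine ⟨α.comp β, fun e n he hE hn hN => ?_⟩
  simp only [Language.Equiv.comp_apply, hβ]
  exact hH.sameOrderedOrbit_of_strictMono hhyp (hp.strictMono_apply _ he)
    (hp.strictMono_apply _ hn) (edgeValue_eq_iff.1 (hcon e n he hE hn hN))

end IsLexFirstProjection

end FraisseLimit

/-! ### The edge values allowed by a constraint -/

section Constraints

variable {ℓ : ℕ} {H : Type u} [(hyperLang ℓ).Structure H] {V : Type x}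

/-- The assignments of edge values to the increasing `ℓ`-tuples of variables which are induced by
the injective maps of a constraint (and are arbitrary on tuples that leave the scope). -/
def Constraint.edgeAssignments (ℓ : ℕ) [(hyperLang ℓ).Structure H] [LinearOrder V]
    (C : Constraint V H) : Set ((Fin ℓ ↪o V) → ZMod 2) :=
  {x | ∃ f ∈ C.maps, Function.Injective f ∧
    ∀ (t : Fin ℓ ↪o V) (ht : ∀ i, t i ∈ C.scope), x t = edgeValue fun i => f ⟨t i, ht i⟩}

theorem Constraint.exists_mem_edgeAssignments [LinearOrder V] {C : Constraint V H}
    {f : C.scope → H} (hf : f ∈ C.maps) (hinj : Function.Injective f) :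
    ∃ x ∈ C.edgeAssignments ℓ, ∀ (t : Fin ℓ ↪o V) (ht : ∀ i, t i ∈ C.scope),
      x t = edgeValue fun i => f ⟨t i, ht i⟩ := by
  classical
  let x : (Fin ℓ ↪o V) → ZMod 2 := fun t =>
    if ht : ∀ i, t i ∈ C.scope then edgeValue fun i => f ⟨t i, ht i⟩ else 0
  have hx : ∀ (t : Fin ℓ ↪o V) (ht : ∀ i, t i ∈ C.scope),
      x t = edgeValue fun i => f ⟨t i, ht i⟩ := fun t ht => dif_pos ht
  exact ⟨x, ⟨f, hf, hinj, hx⟩, hx⟩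

/-- Coordinates leaving the scope are free: flipping one stays in the set but would change the sum.
-/
theorem MinSumConstOn.mem_scope [LinearOrder V] {C : Constraint V H}
    (hne : (C.edgeAssignments ℓ).Nonempty) {T : Finset (Fin ℓ ↪o V)}
    (hT : MinSumConstOn (C.edgeAssignments ℓ) T) {t : Fin ℓ ↪o V} (ht : t ∈ T) (i : Fin ℓ) :
    t i ∈ C.scope := by
  classical
  obtain ⟨x, f, hf, hinj, hx⟩ := hne
  by_contra hi
  have hy : Function.update x t (x t + 1) ∈ C.edgeAssignments ℓ := by
    refine ⟨f, hf, hinj, fun t' ht' => ?_⟩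
    rw [Function.update_of_ne (by rintro rfl; exact hi (ht' i)), hx]
  have h := hT.const x ⟨f, hf, hinj, hx⟩ _ hy
  rw [Finset.sum_update_of_mem ht, ← Finset.add_sum_erase _ _ ht, Finset.sdiff_singleton_eq_erase,
    add_right_comm] at h
  simp at h

variable {LA : FirstOrder.Language.{v, w}} [LA.Structure H] {I : Instance V H}

theorem Instance.IsInstanceOf.map_mem (hI : I.IsInstanceOf LA) {C : Constraint V H}
    (hC : C ∈ I.constraints) {n : ℕ} {p : (Fin n → H) → H} (hp : IsPolymorphism LA p)
    {f : Fin n → C.scope → H} (hf : ∀ i, f i ∈ C.maps) : (fun y => p fun i => f i y) ∈ C.maps := by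
  obtain ⟨k, R, s, -, hR⟩ := hI C hC
  rw [hR] at hf ⊢
  exact hp k R (fun i => f i ∘ s) hf

theorem Instance.IsInstanceOf.map_mem_two (hI : I.IsInstanceOf LA) {C : Constraint V H}
    (hC : C ∈ I.constraints) {p : (Fin 2 → H) → H} (hp : IsPolymorphism LA p)
    {f g : C.scope → H} (hf : f ∈ C.maps) (hg : g ∈ C.maps) :
    (fun y => p ![f y, g y]) ∈ C.maps := by
  have := hI.map_mem hC hp (f := ![f, g]) (by intro i; fin_cases i <;> assumption)
  convert this using 3
  funext i; fin_cases i <;> rfl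

theorem Instance.IsInstanceOf.map_mem_three (hI : I.IsInstanceOf LA) {C : Constraint V H}
    (hC : C ∈ I.constraints) {p : (Fin 3 → H) → H} (hp : IsPolymorphism LA p)
    {f g h : C.scope → H} (hf : f ∈ C.maps) (hg : g ∈ C.maps) (hh : h ∈ C.maps) :
    (fun y => p ![f y, g y, h y]) ∈ C.maps := by
  have := hI.map_mem hC hp (f := ![f, g, h]) (by intro i; fin_cases i <;> assumption)
  convert this using 3
  funext i; fin_cases i <;> rfl

theorem Instance.IsInstanceOf.equiv_mem (hI : I.IsInstanceOf LA)
    (hA : IsFirstOrderReduct ℓ LA H) {C : Constraint V H} (hC : C ∈ I.constraints)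
    (α : H ≃[hyperLang ℓ] H) {f : C.scope → H} (hf : f ∈ C.maps) :
    (fun y => α (f y)) ∈ C.maps := by
  obtain ⟨k, R, s, -, hR⟩ := hI C hC
  rw [hR] at hf ⊢
  exact (relMap_equiv_iff hA R α (f ∘ s)).2 hf

end Constraints

/-! ### Moving partial assignments between constraints -/

section Minimality

variable {ℓ : ℕ} {H : Type u} {V : Type x} [LinearOrder V] {I : Instance V H} {n : ℕ}

theorem Instance.IsMinimal.exists_cover (hmin : I.IsMinimal (2 * ℓ) n) (hn : 3 * ℓ ≤ n)
    (t₁ t₂ t₃ : Fin ℓ ↪o V) : ∃ C ∈ I.constraints,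
      (∀ i, t₁ i ∈ C.scope) ∧ (∀ i, t₂ i ∈ C.scope) ∧ ∀ i, t₃ i ∈ C.scope := by
  classical
  let r : (Fin ℓ ↪o V) → Finset V := fun t => Finset.univ.image t
  have hr : ∀ t, (r t).card ≤ ℓ := fun t => Finset.card_image_le.trans (by simp)
  obtain ⟨C, hC, h⟩ := hmin.1 (r t₁ ∪ r t₂ ∪ r t₃) (by
    have h1 := Finset.card_union_le (r t₁ ∪ r t₂) (r t₃)
    have h2 := Finset.card_union_le (r t₁) (r t₂)
    have := hr t₁; have := hr t₂; have := hr t₃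
    omega)
  refine ⟨C, hC, fun i => h ?_, fun i => h ?_, fun i => h ?_⟩ <;> simp [r]

/-- Two `ℓ`-tuples form one `2ℓ`-tuple, on which the projections of the constraints agree. -/
theorem Instance.IsMinimal.exists_transfer (hmin : I.IsMinimal (2 * ℓ) n) (t₁ t₂ : Fin ℓ ↪o V)
    {C D : Constraint V H} (hC : C ∈ I.constraints) (hD : D ∈ I.constraints)
    (h₁ : ∀ i, t₁ i ∈ C.scope) (h₂ : ∀ i, t₂ i ∈ C.scope) (h₁' : ∀ i, t₁ i ∈ D.scope)
    (h₂' : ∀ i, t₂ i ∈ D.scope) {f : C.scope → H} (hf : f ∈ C.maps) :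
    ∃ f' ∈ D.maps, (fun i => f' ⟨t₁ i, h₁' i⟩) = (fun i => f ⟨t₁ i, h₁ i⟩) ∧
      (fun i => f' ⟨t₂ i, h₂' i⟩) = (fun i => f ⟨t₂ i, h₂ i⟩) := by
  have hmem : ∀ {s : Set V}, (∀ i, t₁ i ∈ s) → (∀ i, t₂ i ∈ s) →
      ∀ i, Fin.append t₁ t₂ i ∈ s := by
    intro s h h' i
    refine Fin.addCases (fun i => ?_) (fun i => ?_) i
    · simpa using h i
    · simpa only [Fin.append_right] using h' i
  have h := hmin.2 (ℓ + ℓ) (by omega) (Fin.append t₁ t₂) C hC D hD (hmem h₁ h₂) (hmem h₁' h₂')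
  have hp : (fun i => f ⟨Fin.append t₁ t₂ i, hmem h₁ h₂ i⟩) ∈
      C.proj fun i => ⟨Fin.append t₁ t₂ i, hmem h₁ h₂ i⟩ := ⟨f, hf, rfl⟩
  rw [h] at hp
  obtain ⟨f', hf', he⟩ := hp
  refine ⟨f', hf', funext fun i => ?_, funext fun i => ?_⟩
  · simpa using congrFun he (Fin.castAdd ℓ i)
  · simpa only [Function.comp_apply, Fin.append_right] using congrFun he (Fin.natAdd ℓ i)

end Minimality

/-! ### Making maps injective with `p₁` -/

section Injective

variable {ℓ : ℕ} {H : Type u} [(hyperLang ℓ).Structure H] [LinearOrder H]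
  {LA : FirstOrder.Language.{v, w}} [LA.Structure H] {p₁ : (Fin 2 → H) → H}
  {V : Type x} {I : Instance V H} {m n : ℕ}

/-- Since `p₁` is injective, combining two maps separates every pair that either separates; induct
over the pairs of the scope. -/
theorem Instance.exists_injective_mem [Finite V] (hp : IsLexFirstProjection ℓ LA p₁)
    (hI : I.IsInstanceOf LA) (hmin : I.IsMinimal m n) (hm : 2 ≤ m) (hne : I.IsNontrivial)
    (hpair : ∀ y z : V, y ≠ z → ∃ a ∈ I.proj ![y, z], Function.Injective a)
    {C : Constraint V H} (hC : C ∈ I.constraints) : ∃ f ∈ C.maps, Function.Injective f := by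
  classical
  have := Fintype.ofFinite (C.scope × C.scope)
  have key : ∀ P : Finset (C.scope × C.scope), ∃ f ∈ C.maps, ∀ q ∈ P, q.1 ≠ q.2 →
      f q.1 ≠ f q.2 := by
    intro P
    induction P using Finset.induction_on with
    | empty =>
      obtain ⟨f, hf⟩ := hne C hC
      exact ⟨f, hf, by simp⟩
    | insert q P _ ih =>
      obtain ⟨f, hf, hfP⟩ := ih
      by_cases hq : q.1 = q.2
      · refine ⟨f, hf, fun q' hq' hne' => ?_⟩
        rcases Finset.mem_insert.1 hq' with rfl | h
        · exact absurd hq hne'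
        · exact hfP q' h hne'
      obtain ⟨a, ⟨D, hD, hDs, ha⟩, hinj⟩ := hpair q.1 q.2 fun h => hq (Subtype.ext h)
      have hCs : ∀ i, ![(q.1 : V), q.2] i ∈ C.scope := by
        intro i; fin_cases i
        · exact q.1.2
        · exact q.2.2
      rw [hmin.2 2 hm ![(q.1 : V), q.2] D hD C hC hDs hCs] at ha
      obtain ⟨g, hg, rfl⟩ := ha
      have hgq : g q.1 ≠ g q.2 := fun h => by
        have := @hinj 0 1 h
        simp at this
      refine ⟨_, hI.map_mem_two hC hp.2.1 hf hg, fun q' hq' hne' h => ?_⟩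
      have h' := hp.1 h
      rcases Finset.mem_insert.1 hq' with rfl | hmem
      · exact hgq (congrFun h' 1)
      · exact hfP q' hmem hne' (congrFun h' 0)
  obtain ⟨f, hf, h⟩ := key Finset.univ
  exact ⟨f, hf, fun y z hyz => by
    by_contra hne'
    exact h (y, z) (Finset.mem_univ _) hne' hyz⟩

/-- Every map in a constraint can be made injective without changing the edge values of
the tuples on which it is injective already. -/
theorem Instance.exists_injective_edgeValue_eq [LinearOrder V]
    (hp : IsLexFirstProjection ℓ LA p₁) (hI : I.IsInstanceOf LA) {C : Constraint V H}
    (hC : C ∈ I.constraints) (hne : ∃ f ∈ C.maps, Function.Injective f) {f : C.scope → H}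
    (hf : f ∈ C.maps) :
    ∃ f' ∈ C.maps, Function.Injective f' ∧ ∀ (t : Fin ℓ ↪o V) (ht : ∀ i, t i ∈ C.scope),
      Function.Injective (fun i => f ⟨t i, ht i⟩) →
        edgeValue (fun i => f' ⟨t i, ht i⟩) = edgeValue fun i => f ⟨t i, ht i⟩ := by
  obtain ⟨g, hg, hginj⟩ := hne
  refine ⟨_, hI.map_mem_two hC hp.2.1 hf hg,
    fun a b hab => hginj (congrFun (hp.1 hab) 1), fun t ht hinj => ?_⟩
  exact hp.edgeValue_apply_of_injective hinj (e := fun i => g ⟨t i, ht i⟩)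
    (hginj.comp fun i j hij => t.injective (congrArg Subtype.val hij))

end Injective

/-! ### Affine structure and non-determinism along minimal equations -/

section EdgeAssignments

variable {ℓ : ℕ} {K : Set (Bundled.{u} (hyperLang ℓ).Structure)}
  {H : Type u} [Countable H] [(hyperLang ℓ).Structure H] [LinearOrder H]
  {LA : FirstOrder.Language.{v, w}} [LA.Structure H]
  {V : Type x} [Finite V] [LinearOrder V] {I : Instance V H} {C : Constraint V H}

/-- Every map of edge values in a constraint is realised by an increasing map. -/
theorem Instance.exists_strictMono_of_mem_edgeAssignments (hH : IsOrderedFraisseLimit K H)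
    (hA : IsFirstOrderReduct ℓ LA H) (hI : I.IsInstanceOf LA) (hC : C ∈ I.constraints)
    {x : (Fin ℓ ↪o V) → ZMod 2} (hx : x ∈ C.edgeAssignments ℓ) :
    ∃ f ∈ C.maps, StrictMono f ∧
      ∀ (t : Fin ℓ ↪o V) (ht : ∀ i, t i ∈ C.scope), x t = edgeValue fun i => f ⟨t i, ht i⟩ := by
  obtain ⟨f, hf, hinj, hx⟩ := hx
  obtain ⟨α, hα⟩ := hH.exists_equiv_strictMono hinj
  exact ⟨_, hI.equiv_mem hA hC α hf, hα, fun t ht =>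
    (hx t ht).trans (edgeValue_eq_iff.2 (isEdge_map_iff α _).symm)⟩

/-- After making the three maps increasing, the linear symmetry adds their edge values. -/
theorem Instance.add_mem_edgeAssignments (hH : IsOrderedFraisseLimit K H)
    (hhyp : IsHypergraph ℓ H) (hA : IsFirstOrderReduct ℓ LA H) (hI : I.IsInstanceOf LA)
    (hC : C ∈ I.constraints) (hsym : AdmitsLinearSymmetries ℓ H LA)
    {x y z : (Fin ℓ ↪o V) → ZMod 2} (hx : x ∈ C.edgeAssignments ℓ)
    (hy : y ∈ C.edgeAssignments ℓ) (hz : z ∈ C.edgeAssignments ℓ) :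
    x + y + z ∈ C.edgeAssignments ℓ := by
  obtain ⟨m, hm⟩ := hsym
  obtain ⟨f, hf, hfm, hx⟩ := exists_strictMono_of_mem_edgeAssignments hH hA hI hC hx
  obtain ⟨g, hg, hgm, hy⟩ := exists_strictMono_of_mem_edgeAssignments hH hA hI hC hy
  obtain ⟨h, hh, hhm, hz⟩ := exists_strictMono_of_mem_edgeAssignments hH hA hI hC hz
  refine ⟨_, hI.map_mem_three hC hm.2.1 hf hg hh,
    fun a b hab => hfm.injective (congrFun (hm.1 hab) 0), fun t ht => ?_⟩
  have ht' : StrictMono fun i => (⟨t i, ht i⟩ : C.scope) := fun i j hij => t.strictMono hij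
  refine Eq.trans ?_
    (hm.edgeValue_apply hH hhyp (hfm.comp ht') (hgm.comp ht') (hhm.comp ht')).symm
  simp only [Pi.add_apply, hx t ht, hy t ht, hz t ht]
  rfl

variable {p₁ : (Fin 2 → H) → H}

/-- On the support of a minimal equation of a constraint, the tuples take only
non-deterministic values if one of them does. -/
theorem Instance.isNonDeterministic_of_minSumConstOn (hH : IsOrderedFraisseLimit K H)
    (hhyp : IsHypergraph ℓ H) (hA : IsFirstOrderReduct ℓ LA H) (hI : I.IsInstanceOf LA)
    (hC : C ∈ I.constraints) (hp : IsLexFirstProjection ℓ LA p₁)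
    {T : Finset (Fin ℓ ↪o V)} (hT : MinSumConstOn (C.edgeAssignments ℓ) T)
    {f : C.scope → H} (hf : f ∈ C.maps) {y z : Fin ℓ ↪o V} (hyT : y ∈ T) (hzT : z ∈ T)
    (hy : ∀ i, y i ∈ C.scope) (hz : ∀ i, z i ∈ C.scope)
    (hfy : IsNonDeterministic p₁ (orbitOf fun i => f ⟨y i, hy i⟩)) :
    IsNonDeterministic p₁ (orbitOf fun i => f ⟨z i, hz i⟩) := by
  classical
  by_contra hfz
  obtain ⟨α, hα⟩ := hp.exists_equiv_edgeValue_eq hfz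
  obtain ⟨e, n, he, hE, hn, hN, hen⟩ := hp.exists_edgeValue_ne hH hhyp hfy α
  have hφ : ∀ t : Fin ℓ ↪o V, ∃ φ : ZMod 2 → ZMod 2, ∀ (ht : ∀ i, t i ∈ C.scope)
      (e : Fin ℓ → H), StrictMono e →
        edgeValue (fun i => p₁ ![α (f ⟨t i, ht i⟩), e i]) = φ (edgeValue e) := by
    intro t
    by_cases ht : ∀ i, t i ∈ C.scope
    · obtain ⟨φ, h⟩ := hp.exists_edgeValue_apply hH hhyp fun i => α (f ⟨t i, ht i⟩)
      exact ⟨φ, fun _ => h⟩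
    · exact ⟨0, fun ht' => absurd ht' ht⟩
  choose φ hφ using hφ
  have hE1 : edgeValue e = 1 := edgeValue_eq_one_iff.2 hE
  have hN0 : edgeValue n = 0 := if_neg hN
  have hφy : φ y 1 ≠ φ y 0 := by
    rwa [hφ y hy e he, hφ y hy n hn, hE1, hN0] at hen
  have hφz : φ z 1 = φ z 0 := by
    have := hα e n he hE hn hN
    rwa [hφ z hz e he, hφ z hz n hn, hE1, hN0] at this
  -- Applying `p₁` to `α ∘ f` and an increasing map acts on edge values coordinatewise by `φ`.
  have hlift : ∀ a ∈ C.edgeAssignments ℓ, ∃ a' ∈ C.edgeAssignments ℓ,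
      ∀ t : Fin ℓ ↪o V, (∀ i, t i ∈ C.scope) → a' t = φ t (a t) := by
    intro a ha
    obtain ⟨g, hg, hgm, ha⟩ := exists_strictMono_of_mem_edgeAssignments hH hA hI hC ha
    obtain ⟨a', ha', h⟩ := Constraint.exists_mem_edgeAssignments (ℓ := ℓ)
      (hI.map_mem_two hC hp.2.1 (hI.equiv_mem hA hC α hf) hg)
      fun a b hab => hgm.injective (congrFun (hp.1 hab) 1)
    refine ⟨a', ha', fun t ht => ?_⟩
    rw [h t ht, ha t ht]
    exact hφ t ht _ fun i j hij => hgm (show (⟨t i, ht i⟩ : C.scope) < ⟨t j, ht j⟩ from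
      t.strictMono hij)
  -- Every self-map of `ZMod 2` is constant or a translation, so the equation for lifted values is
  -- an equation on the coordinates with non-constant `φ t`. These include `y` but not `z`, against
  -- minimality of `T`.
  refine hT.not_const (T.filter fun t => φ t 1 ≠ φ t 0) ?_
    ⟨y, Finset.mem_filter.2 ⟨hyT, hφy⟩⟩ fun a ha c hc => ?_
  · refine (Finset.ssubset_iff_of_subset (Finset.filter_subset _ _)).2 ⟨z, hzT, fun h => ?_⟩
    exact (Finset.mem_filter.1 h).2 hφz
  · obtain ⟨a', ha', h⟩ := hlift a ha
    obtain ⟨c', hc', h'⟩ := hlift c hc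
    have hsum := sub_eq_zero.2 (hT.const a' ha' c' hc')
    rw [← Finset.sum_sub_distrib] at hsum
    rw [← sub_eq_zero, ← Finset.sum_sub_distrib, Finset.sum_filter]
    refine (Finset.sum_congr rfl fun t ht => ?_).trans hsum
    have hts := hT.mem_scope ⟨a, ha⟩ ht
    rw [h t hts, h' t hts]
    have : ∀ (ψ : ZMod 2 → ZMod 2) (p q : ZMod 2),
        (if ψ 1 ≠ ψ 0 then p - q else 0) = ψ p - ψ q := by decide
    exact this _ _ _

end EdgeAssignments

/-! ### Linkedness and components of the equation graph -/

section Components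

variable {ℓ : ℕ} {H : Type u} [(hyperLang ℓ).Structure H] {V : Type x} [LinearOrder V]

/-- Some map in a constraint of `I` sends the tuples `y` and `z` to the orbits `O` and `O'`. -/
def Instance.TupleStep (I : Instance V H) (y z : Fin ℓ ↪o V) (O O' : Orbit ℓ H) : Prop :=
  ∃ C ∈ I.constraints, ∃ (hy : ∀ i, y i ∈ C.scope) (hz : ∀ i, z i ∈ C.scope), ∃ f ∈ C.maps,
    orbitOf (fun i => f ⟨y i, hy i⟩) = O ∧ orbitOf (fun i => f ⟨z i, hz i⟩) = O'

/-- Steps do not depend on `S` beyond their end points, so they can be studied in `I` itself. -/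
theorem Instance.step_restrict_finitisation_iff {I : Instance V H} {S : Set (Fin ℓ ↪o V)}
    {p q : S × Orbit ℓ H} :
    ((I.finitisation ℓ).restrict S).Step p q ↔ I.TupleStep p.1.1 q.1.1 p.2 q.2 := by
  constructor
  · rintro ⟨_, ⟨_, ⟨C, hC, rfl⟩, rfl⟩, hp, hq, g, ⟨g', ⟨f, hf, hfg⟩, hg⟩, h1, h2⟩
    refine ⟨C, hC, hp, hq, f, hf, ?_, ?_⟩
    · rw [← h1, hg]
      exact hfg ⟨p.1.1, hp⟩
    · rw [← h2, hg]
      exact hfg ⟨q.1.1, hq⟩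
  · rintro ⟨C, hC, hp, hq, f, hf, h1, h2⟩
    exact ⟨_, ⟨_, ⟨C, hC, rfl⟩, rfl⟩, hp, hq, fun y => orbitOf fun i => f ⟨y.1.1 i, y.2 i⟩,
      ⟨fun y => orbitOf fun i => f ⟨y.1 i, y.2 i⟩, ⟨f, hf, fun _ => rfl⟩, fun _ => rfl⟩, h1, h2⟩

theorem Instance.TupleStep.symm {I : Instance V H} {y z : Fin ℓ ↪o V} {O O' : Orbit ℓ H}
    (h : I.TupleStep y z O O') : I.TupleStep z y O' O := by
  obtain ⟨C, hC, hy, hz, f, hf, h1, h2⟩ := h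
  exact ⟨C, hC, hz, hy, f, hf, h2, h1⟩

theorem Instance.TupleStep.eq {I : Instance V H} {y : Fin ℓ ↪o V} {O O' : Orbit ℓ H}
    (h : I.TupleStep y y O O') : O = O' := by
  obtain ⟨C, hC, hy, hz, f, hf, h1, h2⟩ := h
  rw [← h1, ← h2]

theorem Instance.Step.symm {V' B : Type*} {J : Instance V' B} {p q : V' × B} (h : J.Step p q) :
    J.Step q p := by
  obtain ⟨C, hC, hp, hq, f, hf, h1, h2⟩ := h
  exact ⟨C, hC, hq, hp, f, hf, h2, h1⟩

theorem Instance.Linked.symm {V' B : Type*} {J : Instance V' B} {y : V'} {a b : B}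
    (h : J.Linked y a b) : J.Linked y b a :=
  have : Std.Symm J.Step := ⟨fun _ _ => Instance.Step.symm⟩
  Std.Symm.symm (r := Relation.TransGen J.Step) _ _ h

/-- Two tuples of variables are adjacent if they occur together in a minimal equation of some
constraint. -/
def Instance.EquationAdj (ℓ : ℕ) [(hyperLang ℓ).Structure H] (I : Instance V H)
    (y z : Fin ℓ ↪o V) : Prop :=
  ∃ C ∈ I.constraints, ∃ T, MinSumConstOn (C.edgeAssignments ℓ) T ∧ y ∈ T ∧ z ∈ T

/-- The connected component of a tuple of variables with respect to the minimal equations. -/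
def Instance.component (ℓ : ℕ) [(hyperLang ℓ).Structure H] (I : Instance V H)
    (y : Fin ℓ ↪o V) : Set (Fin ℓ ↪o V) :=
  {z | Relation.ReflTransGen (I.EquationAdj ℓ) y z}

theorem Instance.EquationAdj.symm {I : Instance V H} {y z : Fin ℓ ↪o V}
    (h : I.EquationAdj ℓ y z) : I.EquationAdj ℓ z y := by
  obtain ⟨C, hC, T, hT, hy, hz⟩ := h
  exact ⟨C, hC, T, hT, hz, hy⟩

theorem Instance.reflTransGen_equationAdj_symm {I : Instance V H} {y z : Fin ℓ ↪o V}
    (h : Relation.ReflTransGen (I.EquationAdj ℓ) y z) :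
    Relation.ReflTransGen (I.EquationAdj ℓ) z y :=
  have : Std.Symm (I.EquationAdj ℓ) := ⟨fun _ _ => Instance.EquationAdj.symm⟩
  Std.Symm.symm (r := Relation.ReflTransGen (I.EquationAdj ℓ)) _ _ h

theorem Instance.component_eq {I : Instance V H} {y z : Fin ℓ ↪o V} (h : z ∈ I.component ℓ y) :
    I.component ℓ z = I.component ℓ y := by
  ext t
  exact ⟨fun ht => h.trans ht, fun ht => (reflTransGen_equationAdj_symm h).trans ht⟩

theorem Instance.mem_scope_of_minSumConstOn {I : Instance V H}
    (hinj : ∀ C ∈ I.constraints, ∃ f ∈ C.maps, Function.Injective f) {C : Constraint V H}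
    (hC : C ∈ I.constraints) {T : Finset (Fin ℓ ↪o V)}
    (hT : MinSumConstOn (C.edgeAssignments ℓ) T) {t : Fin ℓ ↪o V} (ht : t ∈ T) (i : Fin ℓ) :
    t i ∈ C.scope := by
  obtain ⟨f, hf, hfi⟩ := hinj C hC
  obtain ⟨x, hx, -⟩ := Constraint.exists_mem_edgeAssignments (ℓ := ℓ) hf hfi
  exact hT.mem_scope ⟨x, hx⟩ ht i

/-- The linkedness congruence at `y` links the two injective orbits. -/
def Instance.LinksInj {V' : Type*} (J : Instance V' (Orbit ℓ H)) (y : V') : Prop :=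
  ∃ O O' : Orbit ℓ H, IsE O ∧ IsN O' ∧ J.Linked y O O'

theorem Instance.linksInj_of_linked {V' : Type*} {J : Instance V' (Orbit ℓ H)} {y : V'}
    {a b : Fin ℓ → H} (ha : Function.Injective a) (hb : Function.Injective b)
    (hab : edgeValue a ≠ edgeValue b) (h : J.Linked y (orbitOf a) (orbitOf b)) :
    J.LinksInj y := by
  rw [Ne, edgeValue_eq_iff] at hab
  by_cases hE : IsEdge a
  · exact ⟨_, _, isE_orbitOf_iff.2 ⟨ha, hE⟩, isN_orbitOf_iff.2 ⟨hb, fun hE' => hab (by tauto)⟩, h⟩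
  · exact ⟨_, _, isE_orbitOf_iff.2 ⟨hb, by tauto⟩, isN_orbitOf_iff.2 ⟨ha, hE⟩, h.symm⟩

end Components

theorem injective_comp_embedding {ℓ : ℕ} {V H : Type*} [LinearOrder V] {s : Set V}
    {f : s → H} (hf : Function.Injective f)
    (t : Fin ℓ ↪o V) (ht : ∀ i, t i ∈ s) : Function.Injective fun i => f ⟨t i, ht i⟩ :=
  hf.comp fun _ _ hij => t.injective (congrArg Subtype.val hij)

/-! ### Solving the minimal equations component by component -/

section Solve

variable {ℓ : ℕ} {K : Set (Bundled.{u} (hyperLang ℓ).Structure)}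
  {H : Type u} [Countable H] [(hyperLang ℓ).Structure H] [LinearOrder H]
  {LA : FirstOrder.Language.{v, w}} [LA.Structure H] {p₁ : (Fin 2 → H) → H}
  {V : Type x} [LinearOrder V] {I : Instance V H} {n : ℕ}

theorem IsE.eq (hH : IsOrderedFraisseLimit K H) (hhyp : IsHypergraph ℓ H) {O O' : Orbit ℓ H}
    (h : IsE O) (h' : IsE O') : O = O' := by
  obtain ⟨a, rfl, ha, hE⟩ := h
  obtain ⟨b, rfl, hb, hE'⟩ := h'
  exact orbitOf_eq_iff.2 (hH.sameOrbit_of_injective hhyp ha hb (iff_of_true hE hE'))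

theorem IsN.eq (hH : IsOrderedFraisseLimit K H) (hhyp : IsHypergraph ℓ H) {O O' : Orbit ℓ H}
    (h : IsN O) (h' : IsN O') : O = O' := by
  obtain ⟨a, rfl, ha, hE⟩ := h
  obtain ⟨b, rfl, hb, hE'⟩ := h'
  exact orbitOf_eq_iff.2 (hH.sameOrbit_of_injective hhyp ha hb (iff_of_false hE hE'))

theorem IsOrderedFraisseLimit.orbitOf_eq (hH : IsOrderedFraisseLimit K H)
    (hhyp : IsHypergraph ℓ H) {a b : Fin ℓ → H} (ha : Function.Injective a)
    (hb : Function.Injective b) (h : edgeValue a = edgeValue b) : orbitOf a = orbitOf b :=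
  orbitOf_eq_iff.2 (hH.sameOrbit_of_injective hhyp ha hb (edgeValue_eq_iff.1 h))

theorem Instance.LinksInj.reflTransGen {V' : Type*} {J : Instance V' (Orbit ℓ H)} {y : V'}
    (hH : IsOrderedFraisseLimit K H) (hhyp : IsHypergraph ℓ H) (h : J.LinksInj y)
    {O O' : Orbit ℓ H} (hO : IsInjOrbit O) (hO' : IsInjOrbit O') :
    Relation.ReflTransGen J.Step (y, O) (y, O') := by
  obtain ⟨P, P', hP, hP', hl⟩ := h
  rcases hO with hO | hO <;> rcases hO' with hO' | hO'
  · rw [hO.eq hH hhyp hO']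
  · rw [hO.eq hH hhyp hP, hO'.eq hH hhyp hP']
    exact hl.to_reflTransGen
  · rw [hO.eq hH hhyp hP', hO'.eq hH hhyp hP]
    exact hl.symm.to_reflTransGen
  · rw [hO.eq hH hhyp hO']

/-- Within a component, the injective orbits are linked everywhere if they are linked
somewhere. -/
theorem Instance.LinksInj.of_mem_component (hH : IsOrderedFraisseLimit K H)
    (hhyp : IsHypergraph ℓ H) (hinj : ∀ C ∈ I.constraints, ∃ f ∈ C.maps, Function.Injective f)
    {u : Fin ℓ ↪o V} {y z : I.component ℓ u}
    (hyz : Relation.ReflTransGen (I.EquationAdj ℓ) y.1 z.1)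
    (h : ((I.finitisation ℓ).restrict (I.component ℓ u)).LinksInj y) :
    ((I.finitisation ℓ).restrict (I.component ℓ u)).LinksInj z := by
  classical
  obtain ⟨z, hz⟩ := z
  change Relation.ReflTransGen _ _ z at hyz
  induction hyz with
  | refl => exact h
  | @tail t z hyt htz ih =>
    have ht : t ∈ I.component ℓ u := Relation.ReflTransGen.trans y.2 hyt
    specialize ih ht
    by_cases htz' : t = z
    · subst htz'
      exact ih
    obtain ⟨C, hC, T, hT, htT, hzT⟩ := htz
    have hCt := mem_scope_of_minSumConstOn hinj hC hT htT
    have hCz := mem_scope_of_minSumConstOn hinj hC hT hzT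
    -- As `t ≠ z`, minimality of `T` leaves `z` non-constant: both edge values occur there. They
    -- become linked by a detour through `t`, whose injective orbits are already linked.
    have hnc : ¬ SumConstOn (C.edgeAssignments ℓ) {z} :=
      hT.not_const _ ((Finset.ssubset_iff_of_subset (Finset.singleton_subset_iff.2 hzT)).2
        ⟨t, htT, by simpa using htz'⟩) (Finset.singleton_nonempty z)
    simp only [SumConstOn, Finset.sum_singleton, not_forall] at hnc
    obtain ⟨a, ⟨f, hf, hfi, ha⟩, b, ⟨g, hg, hgi, hb⟩, hab⟩ := hnc
    rw [ha z hCz, hb z hCz] at hab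
    have s1 : ((I.finitisation ℓ).restrict (I.component ℓ u)).Step
        (⟨z, hz⟩, orbitOf fun i => f ⟨z i, hCz i⟩) (⟨t, ht⟩, orbitOf fun i => f ⟨t i, hCt i⟩) :=
      step_restrict_finitisation_iff.2 ⟨C, hC, hCz, hCt, f, hf, rfl, rfl⟩
    have s2 : ((I.finitisation ℓ).restrict (I.component ℓ u)).Step
        (⟨t, ht⟩, orbitOf fun i => g ⟨t i, hCt i⟩) (⟨z, hz⟩, orbitOf fun i => g ⟨z i, hCz i⟩) :=
      step_restrict_finitisation_iff.2 ⟨C, hC, hCt, hCz, g, hg, rfl, rfl⟩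
    exact linksInj_of_linked (injective_comp_embedding hfi z hCz)
      (injective_comp_embedding hgi z hCz) hab
      ((Relation.TransGen.head' s1 (ih.reflTransGen hH hhyp
        (isInjOrbit_orbitOf_iff.2 (injective_comp_embedding hfi t hCt))
        (isInjOrbit_orbitOf_iff.2 (injective_comp_embedding hgi t hCt)))).tail s2)

/-- If the injective orbits are not linked in a component, then its minimal equations are solved
by propagating one value. -/
theorem Instance.exists_solution_of_not_linksInj (hH : IsOrderedFraisseLimit K H)
    (hhyp : IsHypergraph ℓ H) (hI : I.IsInstanceOf LA) (hp : IsLexFirstProjection ℓ LA p₁)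
    (hmin : I.IsMinimal (2 * ℓ) n) (hn : 3 * ℓ ≤ n)
    (hinj : ∀ C ∈ I.constraints, ∃ f ∈ C.maps, Function.Injective f) {u : Fin ℓ ↪o V}
    (h : ∀ y, ¬ ((I.finitisation ℓ).restrict (I.component ℓ u)).LinksInj y) :
    ∃ g : (Fin ℓ ↪o V) → ZMod 2, ∀ C ∈ I.constraints, ∀ T,
      MinSumConstOn (C.edgeAssignments ℓ) T → (∀ t ∈ T, t ∈ I.component ℓ u) →
        ∃ x ∈ C.edgeAssignments ℓ, ∑ t ∈ T, g t = ∑ t ∈ T, x t := by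
  have hu : u ∈ I.component ℓ u := Relation.ReflTransGen.refl
  obtain ⟨C₀, hC₀, hu₀, -, -⟩ := hmin.exists_cover hn u u u
  obtain ⟨f₀, hf₀, hfi₀⟩ := hinj C₀ hC₀
  set a₀ : Fin ℓ → H := fun i => f₀ ⟨u i, hu₀ i⟩
  have ha₀ : Function.Injective a₀ := injective_comp_embedding hfi₀ u hu₀
  -- Give each tuple an injective value compatible with the fixed value `a₀` at `u`.
  have hex : ∀ y : Fin ℓ ↪o V, ∃ a : Fin ℓ → H, Function.Injective a ∧
      I.TupleStep u y (orbitOf a₀) (orbitOf a) := by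
    intro y
    obtain ⟨C, hC, hCu, hCy, -⟩ := hmin.exists_cover hn u y y
    obtain ⟨f, hf, h1, -⟩ := hmin.exists_transfer u u hC₀ hC hu₀ hu₀ hCu hCu hf₀
    obtain ⟨f', hf', hfi', h2⟩ := exists_injective_edgeValue_eq (ℓ := ℓ) hp hI hC (hinj C hC) hf
    refine ⟨_, injective_comp_embedding hfi' y hCy, C, hC, hCu, hCy, f', hf', ?_, rfl⟩
    have h3 := h2 u hCu
    rw [h1] at h3
    exact hH.orbitOf_eq hhyp (injective_comp_embedding hfi' u hCu) ha₀ (h3 ha₀)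
  choose a hai hstep using hex
  refine ⟨fun y => edgeValue (a y), fun C hC T hT hTu => ?_⟩
  obtain ⟨t, ht⟩ := hT.nonempty
  have hCt := mem_scope_of_minSumConstOn hinj hC hT ht
  obtain ⟨D, hD, hDu, hDt, f, hf, hfu, hft⟩ := hstep t
  obtain ⟨f', hf', h1, -⟩ := hmin.exists_transfer t t hD hC hDt hDt hCt hCt hf
  obtain ⟨f'', hf'', hfi'', h2⟩ :=
    exists_injective_edgeValue_eq (ℓ := ℓ) hp hI hC (hinj C hC) hf'
  have hti : Function.Injective fun i => f ⟨t i, hDt i⟩ := by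
    rw [← isInjOrbit_orbitOf_iff, hft, isInjOrbit_orbitOf_iff]
    exact hai t
  have h3 : orbitOf (fun i => f'' ⟨t i, hCt i⟩) = orbitOf (a t) := by
    have h4 := h2 t hCt
    rw [h1] at h4
    exact (hH.orbitOf_eq hhyp (injective_comp_embedding hfi'' t hCt) hti (h4 hti)).trans hft
  obtain ⟨x, hx, hxf⟩ := Constraint.exists_mem_edgeAssignments (ℓ := ℓ) hf'' hfi''
  refine ⟨x, hx, Finset.sum_congr rfl fun y hy => ?_⟩
  have hCy := mem_scope_of_minSumConstOn hinj hC hT hy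
  rw [hxf y hCy]
  -- A disagreement would link `E` and `N` at `y`, along `y`, `u`, `t`, `y`.
  by_contra hne
  refine h ⟨y, hTu y hy⟩ (linksInj_of_linked (hai y) (injective_comp_embedding hfi'' y hCy) hne ?_)
  exact ((Relation.TransGen.single
    ((step_restrict_finitisation_iff (q := (⟨u, hu⟩, orbitOf a₀))).2 (hstep y).symm)).tail
    ((step_restrict_finitisation_iff (q := (⟨t, hTu t ht⟩, orbitOf (a t)))).2 (hstep t))).tail
    (step_restrict_finitisation_iff.2 ⟨C, hC, hCt, hCy, f'', hf'', h3, rfl⟩)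

variable [Finite V]

/-- Within a component, non-deterministic values are only compatible with non-deterministic
values. -/
theorem Instance.TupleStep.isNonDeterministic (hH : IsOrderedFraisseLimit K H)
    (hhyp : IsHypergraph ℓ H) (hA : IsFirstOrderReduct ℓ LA H) (hI : I.IsInstanceOf LA)
    (hp : IsLexFirstProjection ℓ LA p₁) (hmin : I.IsMinimal (2 * ℓ) n) (hn : 3 * ℓ ≤ n)
    (hinj : ∀ C ∈ I.constraints, ∃ f ∈ C.maps, Function.Injective f)
    {y z : Fin ℓ ↪o V} (hyz : z ∈ I.component ℓ y) {O O' : Orbit ℓ H}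
    (h : I.TupleStep y z O O') (hO : IsNonDeterministic p₁ O) : IsNonDeterministic p₁ O' := by
  induction hyz generalizing O' with
  | refl => rwa [← h.eq]
  | @tail t z _ htz ih =>
    obtain ⟨C, hC, hCy, hCz, f, hf, rfl, rfl⟩ := h
    -- A constraint on all `3ℓ` variables supplies a value at `t` compatible with both ends; its
    -- values at `t` and `z` are then moved to the constraint `B` that carries the equation.
    obtain ⟨D, hD, hDy, hDt, hDz⟩ := hmin.exists_cover hn y t z
    obtain ⟨f', hf', h1, h2⟩ := hmin.exists_transfer y z hC hD hCy hCz hDy hDz hf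
    have ht := ih ⟨D, hD, hDy, hDt, f', hf', by rw [h1], rfl⟩
    obtain ⟨B, hB, T, hT, htT, hzT⟩ := htz
    have hBt := mem_scope_of_minSumConstOn hinj hB hT htT
    have hBz := mem_scope_of_minSumConstOn hinj hB hT hzT
    obtain ⟨f'', hf'', h3, h4⟩ := hmin.exists_transfer t z hD hB hDt hDz hBt hBz hf'
    rw [← h2, ← h4]
    rw [← h3] at ht
    exact isNonDeterministic_of_minSumConstOn hH hhyp hA hI hB hp hT hf'' htT hzT hBt hBz ht

/-- The minimal equations of each component have a common solution. -/
theorem Instance.exists_solution_component (hH : IsOrderedFraisseLimit K H)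
    (hhyp : IsHypergraph ℓ H) (hA : IsFirstOrderReduct ℓ LA H) (hI : I.IsInstanceOf LA)
    (hp : IsLexFirstProjection ℓ LA p₁) (hmin : I.IsMinimal (2 * ℓ) n) (hn : 3 * ℓ ≤ n)
    (hinj : ∀ C ∈ I.constraints, ∃ f ∈ C.maps, Function.Injective f)
    (hirr : I.IsInjIrreducible ℓ p₁) (u : Fin ℓ ↪o V) :
    ∃ g : (Fin ℓ ↪o V) → ZMod 2, ∀ C ∈ I.constraints, ∀ T,
      MinSumConstOn (C.edgeAssignments ℓ) T → (∀ t ∈ T, t ∈ I.component ℓ u) →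
        ∃ x ∈ C.edgeAssignments ℓ, ∑ t ∈ T, g t = ∑ t ∈ T, x t := by
  classical
  by_cases hL : ∃ y, ((I.finitisation ℓ).restrict (I.component ℓ u)).LinksInj y
  swap
  · exact exists_solution_of_not_linksInj hH hhyp hI hp hmin hn hinj (not_exists.1 hL)
  obtain ⟨y₀, hy₀⟩ := hL
  have hcomp : ∀ y z : I.component ℓ u, Relation.ReflTransGen (I.EquationAdj ℓ) y.1 z.1 :=
    fun y z => (reflTransGen_equationAdj_symm y.2).trans z.2
  rcases hirr.2.2 (I.component ℓ u) with ⟨g, hg⟩ | ⟨y, O₁, O₂, hE, hN, -, -, hnl⟩ |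
    ⟨y, O₁, O₂, hO₁, hO₂, hl⟩
  · have hval : ∀ O : Orbit ℓ H, ∃ c : ZMod 2, ∀ a, orbitOf a = O → edgeValue a = c := by
      intro O
      obtain ⟨a, rfl⟩ := Quotient.exists_rep O
      exact ⟨edgeValue a, fun b hb => edgeValue_eq_iff.2 (orbitOf_eq_iff.1 hb).isEdge_iff⟩
    choose val hval using hval
    refine ⟨fun t => if ht : t ∈ I.component ℓ u then val (g ⟨t, ht⟩) else 0,
      fun C hC T hT hTu => ?_⟩
    obtain ⟨⟨g', ⟨f, hf, hfg⟩, hg'⟩, hgi⟩ := hg _ ⟨_, ⟨_, ⟨C, hC, rfl⟩, rfl⟩, rfl⟩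
    obtain ⟨f', hf', hfi', h1⟩ := exists_injective_edgeValue_eq (ℓ := ℓ) hp hI hC (hinj C hC) hf
    obtain ⟨x, hx, hxf⟩ := Constraint.exists_mem_edgeAssignments (ℓ := ℓ) hf' hfi'
    refine ⟨x, hx, Finset.sum_congr rfl fun t ht => ?_⟩
    have hCt := mem_scope_of_minSumConstOn hinj hC hT ht
    have horb : orbitOf (fun i => f ⟨t i, hCt i⟩) = g ⟨t, hTu t ht⟩ :=
      (hfg ⟨t, hCt⟩).trans (hg' ⟨⟨t, hTu t ht⟩, hCt⟩).symm
    have hti : Function.Injective fun i => f ⟨t i, hCt i⟩ := by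
      rw [← isInjOrbit_orbitOf_iff, horb]
      exact hgi ⟨⟨t, hTu t ht⟩, hCt⟩
    rw [hxf t hCt, h1 t hCt hti, hval _ _ horb]
    exact dif_pos (hTu t ht)
  -- Alternative (ii) contradicts linkedness of `E` and `N` throughout the component.
  · obtain ⟨P, P', hP, hP', hl⟩ := hy₀.of_mem_component hH hhyp hinj (hcomp y₀ y)
    rw [hP.eq hH hhyp hE, hP'.eq hH hhyp hN] at hl
    exact absurd hl hnl
  -- Alternative (iii): a path starting at a non-deterministic value stays non-deterministic and
  -- cannot end in an injective orbit.
  · have key : ∀ p q : I.component ℓ u × Orbit ℓ H, Relation.TransGen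
        ((I.finitisation ℓ).restrict (I.component ℓ u)).Step p q →
        IsNonDeterministic p₁ p.2 → IsNonDeterministic p₁ q.2 := by
      intro p q hpq hp'
      induction hpq with
      | single h =>
        exact (step_restrict_finitisation_iff.1 h).isNonDeterministic hH hhyp hA hI hp hmin hn
          hinj (hcomp _ _) hp'
      | tail _ h ih =>
        exact (step_restrict_finitisation_iff.1 h).isNonDeterministic hH hhyp hA hI hp hmin hn
          hinj (hcomp _ _) ih
    exact absurd hO₁ (key _ _ hl.symm hO₂).1

/-- The injectivisation of the finitisation of an inj-irreducible instance is solvable. -/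
theorem Instance.exists_mem_edgeAssignments (hH : IsOrderedFraisseLimit K H)
    (hhyp : IsHypergraph ℓ H) (hA : IsFirstOrderReduct ℓ LA H) (hI : I.IsInstanceOf LA)
    (hsym : AdmitsLinearSymmetries ℓ H LA)
    (hp : IsLexFirstProjection ℓ LA p₁) (hmin : I.IsMinimal (2 * ℓ) n) (hn : 3 * ℓ ≤ n)
    (hinj : ∀ C ∈ I.constraints, ∃ f ∈ C.maps, Function.Injective f)
    (hirr : I.IsInjIrreducible ℓ p₁) :
    ∃ g : (Fin ℓ ↪o V) → ZMod 2, ∀ C ∈ I.constraints, g ∈ C.edgeAssignments ℓ := by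
  -- Choosing one solution per set `S`, rather than per representative `u`, makes all tuples of a
  -- component use the same one.
  have hG : ∀ S : Set (Fin ℓ ↪o V), ∃ g : (Fin ℓ ↪o V) → ZMod 2,
      ∀ u, I.component ℓ u = S → ∀ C ∈ I.constraints, ∀ T,
        MinSumConstOn (C.edgeAssignments ℓ) T → (∀ t ∈ T, t ∈ S) →
          ∃ x ∈ C.edgeAssignments ℓ, ∑ t ∈ T, g t = ∑ t ∈ T, x t := by
    intro S
    by_cases hS : ∃ u, I.component ℓ u = S
    · obtain ⟨u, rfl⟩ := hS
      obtain ⟨g, hg⟩ := exists_solution_component hH hhyp hA hI hp hmin hn hinj hirr u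
      exact ⟨g, fun _ _ => hg⟩
    · exact ⟨0, fun u hu => absurd ⟨u, hu⟩ hS⟩
  choose G hG using hG
  refine ⟨fun t => G (I.component ℓ t) t, fun C hC => ?_⟩
  have : Finite (Fin ℓ ↪o V) := Finite.of_injective (fun t => (t : Fin ℓ → V))
    DFunLike.coe_injective
  obtain ⟨f, hf, hfi⟩ := hinj C hC
  obtain ⟨x₀, hx₀, -⟩ := Constraint.exists_mem_edgeAssignments (ℓ := ℓ) hf hfi
  refine mem_of_minSumConstOn ⟨x₀, hx₀⟩ (fun x hx y hy z hz =>
    add_mem_edgeAssignments hH hhyp hA hI hC hsym hx hy hz) fun T hT => ?_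
  obtain ⟨t, ht⟩ := hT.nonempty
  have hTt : ∀ y ∈ T, y ∈ I.component ℓ t := fun y hy =>
    Relation.ReflTransGen.single ⟨C, hC, T, hT, ht, hy⟩
  obtain ⟨x, hx, h⟩ := hG _ t rfl C hC T hT hTt
  refine ⟨x, hx, Eq.trans (Finset.sum_congr rfl fun y hy => ?_) h⟩
  rw [component_eq (hTt y hy)]

end Solve

/-! ### The hypergraph on the variables -/

section Final

variable {ℓ : ℕ} {V : Type x} [LinearOrder V]

/-- The hyperedges on a linearly ordered set that are determined by a set of increasing tuples. -/
def EdgeOfAssignment (g : (Fin ℓ ↪o V) → ZMod 2) (s : Fin ℓ → V) : Prop :=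
  Function.Injective s ∧ ∃ t : Fin ℓ ↪o V, Set.range t = Set.range s ∧ g t = 1

theorem EdgeOfAssignment.comp_perm {g : (Fin ℓ ↪o V) → ZMod 2} {s : Fin ℓ → V}
    (h : EdgeOfAssignment g s) (σ : Equiv.Perm (Fin ℓ)) : EdgeOfAssignment g (s ∘ σ) := by
  obtain ⟨hs, t, ht, hg⟩ := h
  exact ⟨hs.comp σ.injective, t, by rw [ht, σ.surjective.range_comp], hg⟩

/-- Both sides are permutation invariant and fail on non-injective tuples, so it suffices to compare
them on the sorted tuple. -/
theorem edgeOfAssignment_iff {H : Type u} [(hyperLang ℓ).Structure H] (hhyp : IsHypergraph ℓ H)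
    {C : Constraint V H} {g : (Fin ℓ ↪o V) → ZMod 2} {f : C.scope → H}
    (hg : ∀ (t : Fin ℓ ↪o V) (ht : ∀ i, t i ∈ C.scope),
      g t = edgeValue fun i => f ⟨t i, ht i⟩) (s : Fin ℓ → C.scope) :
    EdgeOfAssignment g (fun i => (s i : V)) ↔ IsEdge (f ∘ s) := by
  by_cases hs : Function.Injective s
  swap
  · exact iff_of_false (fun h => hs (h.1.of_comp (f := fun y : C.scope => (y : V))))
      fun h => hs (hhyp.1 _ h).of_comp
  have hmono : StrictMono fun i => (s (Tuple.sort s i) : V) :=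
    (Tuple.monotone_sort s).strictMono_of_injective (hs.comp (Tuple.sort s).injective)
  let t : Fin ℓ ↪o V := OrderEmbedding.ofStrictMono _ hmono
  have ht : ∀ i, t i ∈ C.scope := fun i => (s (Tuple.sort s i)).2
  have hrange : Set.range t = Set.range fun i => (s i : V) :=
    (Tuple.sort s).surjective.range_comp fun i => (s i : V)
  have h1 : EdgeOfAssignment g (fun i => (s i : V)) ↔ g t = 1 := by
    constructor
    · rintro ⟨-, t', ht', hg'⟩
      rwa [← OrderEmbedding.range_inj.1 (ht'.trans hrange.symm)]
    · exact fun h => ⟨Subtype.val_injective.comp hs, t, hrange, h⟩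
  rw [h1, hg t ht, edgeValue_eq_one_iff]
  exact hhyp.isEdge_comp_perm (f ∘ s) (Tuple.sort s)

end Final

end HypergraphCSP

/-! ### From edge values to an injective solution -/

theorem mainTheorem2 {ℓ : ℕ} (hℓ : 3 ≤ ℓ)
    (K : Set (Bundled.{u} (hyperLang ℓ).Structure)) (b : ℕ) (hKb : IsFinitelyBoundedBy K b)
    (hK : Language.IsFraisse (orderedClass K))
    {H : Type u} [Countable H] [(hyperLang ℓ).Structure H] [LinearOrder H]
    (hH : IsOrderedFraisseLimit K H)
    (LA : FirstOrder.Language.{v, w}) [LA.IsRelational] [LA.Structure H]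
    (hA : IsFirstOrderReduct ℓ LA H) (hsym : AdmitsLinearSymmetries ℓ H LA)
    (p₁ : (Fin 2 → H) → H) (hp₁ : IsLexFirstProjection ℓ LA p₁)
    {V : Type x} [Finite V] [LinearOrder V] (I : Instance V H) (hI : I.IsInstanceOf LA)
    (hmin : I.IsMinimal (2 * ℓ) (max (3 * ℓ) b)) (hirr : I.IsInjIrreducible ℓ p₁)
    (hpair : ∀ y z : V, y ≠ z → ∃ a ∈ I.proj ![y, z], Function.Injective a) :
    ∃ f : V → H, Function.Injective f ∧ I.IsSolution f := by
  classical
  obtain ⟨F, -, hF, hKF⟩ := hKb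
  have hhyp : IsHypergraph ℓ H := hH.isHypergraph fun M hM => ((hKF M).1 hM).1
  have hinj : ∀ C ∈ I.constraints, ∃ f ∈ C.maps, Function.Injective f := fun C hC =>
    Instance.exists_injective_mem hp₁ hI hmin (by omega) hirr.1 hpair hC
  obtain ⟨g, hg⟩ := Instance.exists_mem_edgeAssignments hH hhyp hA hI hsym hp₁ hmin
    (le_max_left _ _) hinj hirr
  obtain ⟨j, hj, hjE⟩ := hH.exists_strictMono_of_equiv (ι := V) (E := EdgeOfAssignment g) (by
    intro M e
    let hM : (hyperLang ℓ).Structure M := structureOfEdges fun s => EdgeOfAssignment g (e ∘ s)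
    refine (hKF _).2 ⟨⟨fun s hs => (hs.1.of_comp : Function.Injective s),
      fun s σ hs => hs.comp_perm σ⟩, .of_equiv _ e.symm, fun N hN => ⟨fun φ' => ?_⟩⟩
    let φ : N ↪[hyperLang ℓ] M := φ'
    obtain ⟨-, hNfin, hNb⟩ := hF N hN
    have := Fintype.ofFinite N
    obtain ⟨C, hC, hCN⟩ := hmin.1 (Finset.univ.image fun y : N => e (φ y))
      ((Finset.card_image_le.trans (by rwa [Finset.card_univ, ← Nat.card_eq_fintype_card])).trans
        (le_max_right _ _))
    obtain ⟨f, -, hfi, hfg⟩ := hg C hC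
    have hmem : ∀ y : N, e (φ y) ∈ C.scope := fun y => hCN (by simp)
    -- The image of `N` has at most `b` elements and lies in one scope, where `f` realises the edges
    -- in `H`. So `N` is in `K`, although it embeds into itself.
    have hNK : N ∈ K := hH.mem_of_embeds N.str (j := fun y => f ⟨e (φ y), hmem y⟩)
      (fun y z hyz => φ.injective (e.injective (congrArg Subtype.val (hfi hyz)))) fun s =>
        (edgeOfAssignment_iff hhyp hfg fun i => ⟨e (φ (s i)), hmem (s i)⟩).symm.trans
          (φ.map_rel EdgeSymbol.edge s)
    exact (((hKF N).1 hNK).2.2 N hN).false (Language.Embedding.refl _ _))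
  refine ⟨j, hj.injective, fun C hC => ?_⟩
  obtain ⟨f, hf, hfi, hfg⟩ := hg C hC
  -- On the scope, `j` and `f` induce the same hypergraph, so an automorphism carries the allowed
  -- map `f` to `j`.
  obtain ⟨α, hα⟩ := hH.exists_equiv f (fun y : C.scope => j y)
    (fun y z => by rw [hfi.eq_iff, hj.injective.eq_iff, Subtype.ext_iff]) fun s =>
      (edgeOfAssignment_iff hhyp hfg s).symm.trans (hjE fun i => (s i : V)).symm
  have := hI.equiv_mem hA hC α hf
  rwa [show (fun y => α (f y)) = fun y : C.scope => j y from funext hα] at this
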